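/- Let $\mathcal X$ be a domain, let $\mathcal Y$ be a countable label space (for instance $\mathcal Y=[k]$), and let $\mathcal H\subseteq\mathcal Y^{\mathcal X}$ be a class of finite DS dimension $d_{\mathrm{DS}}$. Here $d_{\mathrm{DS}}$ is the largest $n$ for which there are points $x_1,\dots,x_n$ and a finite non-empty set $F\subseteq \mathcal H|_{(x_1,\dots,x_n)}\subseteq\mathcal Y^n$ such that for every $f\in F$ and every $i$ some $g\in F$ differs from $f$ exactly in the coordinate $i$. For a distribution $\mathcal D$ over $\mathcal X\times\mathcal Y$ let $\mathrm{err}_{\mathcal D}(f)=\Pr_{(x,y)\sim\mathcal D}[f(x)\ne y]$, and call $\mathcal D$ realizable by $\mathcal H$ if $\inf_{h\in\mathcal H}\mathrm{err}_{\mathcal D}(h)=0$. Assume the usual measurability: countably many measurable sets separate the points of $\mathcal X$, all subsets of $\mathcal Y$ are measurable, and for all $n$ and $y\in\mathcal Y^n$ the set $\{x\in\mathcal X^n: y\in\mathcal H|_x\}$ is measurable up to null sets for $\mu^n$, for every distribution $\mu$ on $\mathcal X$. The one-inclusion graph of $W\subseteq\mathcal Y^n$ is the hypergraph with vertex set $W$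 whose edges are, for each direction $i$, the classes of vertices that agree in all coordinates other than $i$. An orientation maps each edge to one of its vertices, and the out-degree of a vertex is the number of edges that contain it and are not mapped to it. A one-inclusion graph predictor fixes, for every finite set of points listed with multiplicity (independently of their order), an orientation of the one-inclusion graph of the restriction of $\mathcal H$ to these points with the smallest possible maximum out-degree. Given a labelled sample $(x_1,y_1),\dots,(x_n,y_n)$ and a test point $x$, it predicts the label that is given to $x$ by the vertex to which the edge of all vertices of $\mathcal H|_{(x_1,\dots,x_n,x)}$ with labels $y_1,\dots,y_n$ on $x_1,\dots,x_n$ is mapped (and an arbitrary label if there is no such vertex). (1) $\mathcal H$ is PAC learnable in the realizable setting. More precisely, there is a learning algorithm $\mathcal A$, namely the majority (plurality) vote of the predictions of some one-inclusion graph predictor trained on the prefixes of length $t$ of the sample, $m/4\le t\le m-1$, such that for every distribution $\mathcal D$ realizable by $\mathcal H$, all $\varepsilon,\delta\in(0,1)$ and all $$m\ \ge\ 9.64\left(\frac{d_{\mathrm{DS}}+\log(2/\delta)}{\varepsilon}\right),$$ with probability at least $1-\delta$ over $S\sim\mathcal D^m$ it holds that $\mathrm{err}_{\mathcal D}(\mathcal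 A(S))\le\varepsilon$. (2) Let $m_{\mathcal H}(\varepsilon,\delta)$ be the optimal sample complexity, that is, the smallest $M$ such that some learning algorithm $\mathcal A$ satisfies $\Pr_{S\sim\mathcal D^m}[\mathrm{err}_{\mathcal D}(\mathcal A(S))\ge\varepsilon]\le\delta$ for all $m\ge M$ and all $\mathcal D$ realizable by $\mathcal H$. Assume that $\mathcal H$ is non-degenerate: two of its members agree at some point and differ at another one (this always holds if $d_{\mathrm{DS}}\ge2$). Then $$m_{\mathcal H}(\varepsilon,\delta)=\Theta\left(\frac{d_{\mathrm{DS}}+\log(1/\delta)}{\varepsilon}\right),$$ that is, with absolute constants $c,C>0$, which depend neither on $\mathcal X$, $\mathcal Y$ nor on $\mathcal H$, one has $c\,\frac{d_{\mathrm{DS}}+\log(1/\delta)}{\varepsilon}\le m_{\mathcal H}(\varepsilon,\delta)\le C\,\frac{d_{\mathrm{DS}}+\log(1/\delta)}{\varepsilon}$ for all $\varepsilon,\delta\in(0,1/8]$. -/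

import Mathlib

open MeasureTheory
open scoped ENNReal

noncomputable section

/-! ### Hypothesis classes, restrictions and the DS dimension -/

/-- The restriction `H|_x` of a class `H ⊆ Y^X` to a finite sequence of points `x`,
as a set of vectors in `Y^n`. -/
def restrict {X Y : Type*} (H : Set (X → Y)) {n : ℕ} (x : Fin n → X) : Set (Fin n → Y) :=
  (fun h => h ∘ x) '' H

/-- `f` and `g` are `i`-neighbours: they differ at `i` and agree everywhere else. -/
def IsNeighbor {Y : Type*} {n : ℕ} (i : Fin n) (f g : Fin n → Y) : Prop :=
  f i ≠ g i ∧ ∀ j, j ≠ i → f j = g j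

/-- `H` DS-shatters the sequence `x`: some finite nonempty `F ⊆ H|_x` contains, for each of its
members and each direction `i`, an `i`-neighbour of that member. -/
def DSShatters {X Y : Type*} (H : Set (X → Y)) {n : ℕ} (x : Fin n → X) : Prop :=
  ∃ F : Set (Fin n → Y), F.Finite ∧ F.Nonempty ∧ F ⊆ restrict H x ∧
    ∀ f ∈ F, ∀ i, ∃ g ∈ F, IsNeighbor i f g

/-- `d` is the DS dimension of `H`: the largest length of a DS-shattered sequence. -/
def HasDSDim {X Y : Type*} (H : Set (X → Y)) (d : ℕ) : Prop :=
  IsGreatest {n : ℕ | ∃ x : Fin n → X, DSShatters H x} d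

/-! ### One-inclusion graphs and their orientations -/

/-- The restriction of a vector to the coordinates other than `i`. -/
def off {Y : Type*} {n : ℕ} (i : Fin n) (w : Fin n → Y) : {j : Fin n // j ≠ i} → Y :=
  fun j => w j

/-- The edge `e_{i,f}` of the one-inclusion graph of `W`: all vertices `w ∈ W` that agree with `f`
off the coordinate `i`. The edges of the graph are the nonempty ones, indexed by `(i, f)`. -/
def oigEdge {Y : Type*} {n : ℕ} (W : Set (Fin n → Y)) (i : Fin n)
    (f : {j : Fin n // j ≠ i} → Y) : Set (Fin n → Y) :=
  {w | w ∈ W ∧ off i w = f}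

/-- An assignment of a vertex to every index `(i, f)` of an edge. -/
abbrev EdgeMap (Y : Type*) (n : ℕ) : Type _ :=
  (i : Fin n) → ({j : Fin n // j ≠ i} → Y) → (Fin n → Y)

/-- `σ` is an orientation of the one-inclusion graph of `W`: every edge is mapped to one of the
vertices it contains. -/
def IsOrientation {Y : Type*} {n : ℕ} (W : Set (Fin n → Y)) (σ : EdgeMap Y n) : Prop :=
  ∀ i f, (oigEdge W i f).Nonempty → σ i f ∈ oigEdge W i f

/-- The out-degree of a vertex `w`: the number of the edges containing `w` (one in each direction)
that are not oriented to `w`. -/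
def outdeg {Y : Type*} {n : ℕ} (σ : EdgeMap Y n) (w : Fin n → Y) : ℕ :=
  {i : Fin n | σ i (off i w) ≠ w}.ncard

/-- `σ` is an orientation of the one-inclusion graph of `W` whose maximum out-degree is the
smallest possible. -/
def IsOptimalOrientation {Y : Type*} {n : ℕ} (W : Set (Fin n → Y)) (σ : EdgeMap Y n) : Prop :=
  IsOrientation W σ ∧ ∀ σ' : EdgeMap Y n, IsOrientation W σ' →
    ∀ r : ℕ, (∀ w ∈ W, outdeg σ' w ≤ r) → ∀ w ∈ W, outdeg σ w ≤ r

/-! ### Learning algorithms -/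

/-- A (deterministic) learning algorithm maps a labelled sample of any size to a predictor. -/
abbrev Learner (X Y : Type*) : Type _ :=
  (m : ℕ) → (Fin m → X × Y) → X → Y

/-- `P` is a one-inclusion graph predictor for `H`. Each sequence of points `x` has an orientation
`O x` of the one-inclusion graph of `H|_x` with the smallest maximum out-degree, and reordering the
points only reorders the coordinates, so that the orientation does not depend on which of the
points is the test point. Given the sample `S` and the test point `x`, the predictor takes the edge
formed by the members of `H|_{(x_1, …, x_n, x)}` that agree with the labels of `S`, and returns the
label that the vertex to which this edge is oriented gives to `x`. If no member agrees with the
labels, then the prediction is unrestricted. -/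
def IsOIGPredictor {X Y : Type*} (H : Set (X → Y)) (P : Learner X Y) : Prop :=
  ∃ O : (n : ℕ) → (Fin n → X) → EdgeMap Y n,
    (∀ n (x : Fin n → X), IsOptimalOrientation (restrict H x) (O n x)) ∧
    (∀ n (x : Fin n → X) (π : Equiv.Perm (Fin n)), ∀ w ∈ restrict H x, ∀ i,
      O n (x ∘ π) i (off i (w ∘ π)) = O n x (π i) (off (π i) w) ∘ π) ∧
    ∀ n (S : Fin n → X × Y) (x : X) (f : {j : Fin (n + 1) // j ≠ Fin.last n} → Y),
      (∀ (i : Fin n) (hi : i.castSucc ≠ Fin.last n), f ⟨i.castSucc, hi⟩ = (S i).2) →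
      (oigEdge (restrict H (Fin.snoc (α := fun _ => X) (fun i => (S i).1) x))
        (Fin.last n) f).Nonempty →
      P n S x =
        O (n + 1) (Fin.snoc (α := fun _ => X) (fun i => (S i).1) x) (Fin.last n) f (Fin.last n)

/-- The number of prefix lengths `t` with `m / 4 ≤ t ≤ m - 1` for which `P`, trained on the first
`t` examples of `S`, predicts the label `y` at `x`. -/
def prefixVotes {X Y : Type*} (P : Learner X Y) {m : ℕ} (S : Fin m → X × Y) (x : X) (y : Y) : ℕ :=
  {t : Fin m | m ≤ 4 * (t : ℕ) ∧ P t (fun i => S (Fin.castLE t.isLt.le i)) x = y}.ncard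

/-- `A` is a majority vote over the predictors that `P` outputs on growing prefixes of the sample:
the label predicted by `A` has the largest number of votes (ties are broken arbitrarily). -/
def IsPrefixMajority {X Y : Type*} (P A : Learner X Y) : Prop :=
  ∀ m (S : Fin m → X × Y) (x : X) (y : Y), prefixVotes P S x y ≤ prefixVotes P S x (A m S x)

/-! ### Realizable PAC learning

The value of a measure at a set that is not measurable is its outer measure, so the bounds on the
probability of failure below do not need the learner to be measurable. -/

/-- The error of a predictor under the distribution `D`. -/
def err {X Y : Type*} [MeasurableSpace X] [MeasurableSpace Y] (D : Measure (X × Y))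
    (f : X → Y) : ℝ≥0∞ :=
  D {p | f p.1 ≠ p.2}

/-- `D` is realizable by `H`. -/
def Realizable {X Y : Type*} [MeasurableSpace X] [MeasurableSpace Y] (H : Set (X → Y))
    (D : Measure (X × Y)) : Prop :=
  ⨅ h ∈ H, err D h = 0

/-- With samples of size at least `M`, the learner `A` reaches error less than `ε` with
probability at least `1 - δ`, under every distribution that is realizable by `H`. -/
def LearnsFrom {X Y : Type*} [MeasurableSpace X] [MeasurableSpace Y] (H : Set (X → Y))
    (A : Learner X Y) (ε δ : ℝ) (M : ℕ) : Prop :=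
  ∀ D : Measure (X × Y), IsProbabilityMeasure D → Realizable H D → ∀ m : ℕ, M ≤ m →
    Measure.pi (fun _ : Fin m => D) {S | ENNReal.ofReal ε ≤ err D (A m S)} ≤ ENNReal.ofReal δ

/-- `H` is PAC learnable by `A` in the realizable setting (with some sample complexity). -/
def PACLearns {X Y : Type*} [MeasurableSpace X] [MeasurableSpace Y] (H : Set (X → Y))
    (A : Learner X Y) : Prop :=
  ∃ M : ℝ → ℝ → ℕ, ∀ ε ∈ Set.Ioo (0 : ℝ) 1, ∀ δ ∈ Set.Ioo (0 : ℝ) 1, LearnsFrom H A ε δ (M ε δ)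

/-- `M` is the optimal sample complexity of learning `H` in the realizable setting with error `ε`
and confidence `1 - δ`: the smallest one that any learner achieves. -/
def IsOptimalSampleComplexity {X Y : Type*} [MeasurableSpace X] [MeasurableSpace Y]
    (H : Set (X → Y)) (ε δ : ℝ) (M : ℕ) : Prop :=
  IsLeast {M : ℕ | ∃ A : Learner X Y, LearnsFrom H A ε δ M} M

/-- The measurability that is needed for the probabilities to make sense: the set of the point
sequences on which `H` realizes a given label pattern is measurable up to null sets, for the powers
of every distribution on `X`. -/
def MeasurablePatterns {X Y : Type*} [MeasurableSpace X] (H : Set (X → Y)) : Prop :=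
  ∀ (n : ℕ) (y : Fin n → Y) (μ : Measure X), IsProbabilityMeasure μ →
    NullMeasurableSet {x : Fin n → X | y ∈ restrict H x} (Measure.pi fun _ : Fin n => μ)

/-- Some two members of `H` agree at one point and differ at another one. (Otherwise, a single
labelled example determines the target, so that one example suffices for learning.) -/
def Nondegenerate {X Y : Type*} (H : Set (X → Y)) : Prop :=
  ∃ h ∈ H, ∃ g ∈ H, ∃ x x' : X, h x = g x ∧ h x' ≠ g x'

end

/-! The upper bound combines a leave-one-out bound with a concentration argument that costs no
logarithmic factor.

Leave-one-out: on a finite vertex set without pseudo-cubes of dimension above `d`, the indicators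
that read at most `d` coordinates span all functions (`cylInd_mem_juntaSpan`). A basis of such
indicators, counted direction by direction, gives the edge density `card_mul_le_sum_card_image_off`,
and Hall's theorem turns the density into an orientation with out-degrees at most `d`. Hence an
order-invariant predictor errs for at most `d` of the `t + 1` choices of the held-out point
(`exists_leaveOneOut`). To make the predictor measurable, the optimal selection of edges is the
lexicographically largest one in a compact set of bit sequences, computed for the points sorted by
an injective real key.

Concentration: let `x_t` indicate the error on the next example after training on `t` examples, and
let `q_t` be its conditional probability. Forwards in time, `exp (∑ ((1 - exp (-l)) q_t - l x_t))`
is a supermartingale (`lintegral_exp_martingale_le_one`). Backwards in time, `x_t` has mean at most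
`d / (t + 1)` given the unordered first `t + 1` examples and everything later, which controls the
exponential moments of `∑ x_t` (`lintegral_prod_reversed_le`). Two Markov inequalities then bound `∑
q_t` (`measure_sum_nextProb_ge_le`). Starting at `t ≥ m / 4` keeps `∑ d / (t + 1)` at most `d log
4`, and the plurality vote errs at most twice as much as its average voter.

Lower bound: a point of mass `ε` that separates two members stays unseen with probability `(1 - ε) ^
M`, which gives `log (1 / δ) / ε`. Spreading mass `4 ε` over a shattered sequence and averaging over
the pseudo-cube gives `d / ε`. -/

/-! ### Finite sets of vectors without pseudo-cubes of large dimension -/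

/-- No projection of `W` to more than `d` coordinates contains a finite nonempty pseudo-cube. -/
def PseudoCubeFree {Y : Type*} {n : ℕ} (d : ℕ) (W : Set (Fin n → Y)) : Prop :=
  ∀ (k : ℕ) (e : Fin k ↪o Fin n), d < k → ∀ F : Set (Fin k → Y), F.Finite → F.Nonempty →
    F ⊆ (fun w => w ∘ e) '' W → ¬ ∀ f ∈ F, ∀ i, ∃ g ∈ F, IsNeighbor i f g

lemma HasDSDim.pseudoCubeFree {X Y : Type*} {H : Set (X → Y)} {d : ℕ} (h : HasDSDim H d) {n : ℕ}
    (x : Fin n → X) : PseudoCubeFree d (restrict H x) := by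
  intro k e hk F hF hne hsub hnb
  refine absurd (h.2 ⟨x ∘ e, F, hF, hne, fun f hf => ?_, hnb⟩) (by omega)
  obtain ⟨_, ⟨g, hg, rfl⟩, rfl⟩ := hsub hf
  exact ⟨g, hg, rfl⟩

open Classical in
/-- The indicator, as a function on `U`, of the vectors that agree with `v` on `S`. -/
noncomputable def cylInd {Y : Type*} {n : ℕ} (U : Finset (Fin n → Y)) (S : Finset (Fin n))
    (v : Fin n → Y) : U → ℚ :=
  fun w => if ∀ j ∈ S, w.1 j = v j then 1 else 0

lemma cylInd_apply {Y : Type*} {n : ℕ} {U : Finset (Fin n → Y)} {S : Finset (Fin n)}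
    {v : Fin n → Y} {w : U} {p : Prop} [Decidable p] (h : (∀ j ∈ S, w.1 j = v j) ↔ p) :
    cylInd U S v w = if p then 1 else 0 := by
  by_cases hp : p
  · rw [if_pos hp, cylInd, if_pos (h.2 hp)]
  · rw [if_neg hp, cylInd, if_neg (mt h.1 hp)]

lemma exists_mem_of_cylInd_ne_zero {Y : Type*} {n : ℕ} {U : Finset (Fin n → Y)}
    {S : Finset (Fin n)} {v : Fin n → Y} (h : cylInd U S v ≠ 0) :
    ∃ w ∈ U, ∀ j ∈ S, w j = v j := by
  by_contra! hc
  refine h (funext fun w => ?_)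
  obtain ⟨j, hj, hne⟩ := hc w w.2
  simp only [cylInd, Pi.zero_apply, ite_eq_right_iff, one_ne_zero, imp_false]
  exact fun h => hne (h j hj)

-- Summing out one coordinate is the relation that forces an indicator outside a subspace to have a
-- neighbouring indicator outside it.
open Classical in
lemma cylInd_erase {Y : Type*} {n : ℕ} (U : Finset (Fin n → Y)) {S : Finset (Fin n)} {i : Fin n}
    (hi : i ∈ S) (v : Fin n → Y) :
    cylInd U (S.erase i) v =
      ∑ y ∈ U.image (fun w => w i), cylInd U S (Function.update v i y) := by
  funext w
  have key : ∀ y, (∀ j ∈ S, w.1 j = Function.update v i y j) ↔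
      w.1 i = y ∧ ∀ j ∈ S.erase i, w.1 j = v j := by
    intro y
    constructor
    · intro h
      refine ⟨by simpa using h i hi, fun j hj => ?_⟩
      have := h j (Finset.mem_of_mem_erase hj)
      rwa [Function.update_of_ne (Finset.ne_of_mem_erase hj)] at this
    · rintro ⟨h1, h2⟩ j hj
      by_cases hji : j = i
      · subst hji; simpa using h1
      · rw [Function.update_of_ne hji]; exact h2 j (Finset.mem_erase.2 ⟨hji, hj⟩)
  rw [Finset.sum_apply, Finset.sum_congr rfl fun y _ => cylInd_apply (key y), cylInd_apply Iff.rfl]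
  by_cases h : ∀ j ∈ S.erase i, w.1 j = v j
  · simp only [if_pos h, and_iff_left h]
    rw [Finset.sum_eq_single (w.1 i)]
    · simp
    · intro y _ hy; simp [hy.symm]
    · intro h'; exact absurd (Finset.mem_image_of_mem _ w.2) h'
  · simp only [h, and_false, if_false, Finset.sum_const_zero]

/-- The span of the indicators that depend on at most `d` coordinates. -/
noncomputable def juntaSpan {Y : Type*} {n : ℕ} (d : ℕ) (U : Finset (Fin n → Y)) :
    Submodule ℚ (U → ℚ) :=
  Submodule.span ℚ {f | ∃ S : Finset (Fin n), S.card ≤ d ∧ ∃ v, f = cylInd U S v}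

/-- For a minimal `S` with an indicator outside the span, the patterns on `S` of all such indicators
form a pseudo-cube. Indeed, summing out a coordinate gives an element of the span by minimality, so
a single summand cannot be the only one outside. -/
lemma cylInd_mem_juntaSpan {Y : Type*} {n d : ℕ} {W : Set (Fin n → Y)} (hW : PseudoCubeFree d W)
    {U : Finset (Fin n → Y)} (hU : (U : Set (Fin n → Y)) ⊆ W) (S : Finset (Fin n)) :
    ∀ v, cylInd U S v ∈ juntaSpan d U := by
  classical
  induction S using Finset.strongInduction with
  | H S ih =>
    by_contra! hex
    obtain ⟨v₀, hv₀⟩ := hex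
    have hS : d < S.card := by
      by_contra hle
      exact hv₀ (Submodule.subset_span ⟨S, not_lt.1 hle, v₀, rfl⟩)
    let e := S.orderEmbOfFin rfl
    have heS : ∀ a, e a ∈ S := fun a => S.orderEmbOfFin_mem rfl a
    have hagree : ∀ v, cylInd U S v ∉ juntaSpan d U → ∃ w ∈ U, ∀ j ∈ S, w j = v j := fun v hv =>
      exists_mem_of_cylInd_ne_zero fun h0 => hv (h0 ▸ Submodule.zero_mem _)
    -- An indicator outside the span is nonzero, so its pattern occurs in `U`. This gives both
    -- finiteness and realizability of the pseudo-cube.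
    have hsub : {f | ∃ v, cylInd U S v ∉ juntaSpan d U ∧ f = v ∘ e} ⊆
        (fun w : Fin n → Y => w ∘ e) '' (U : Set (Fin n → Y)) := by
      rintro _ ⟨v, hv, rfl⟩
      obtain ⟨w, hw, hwv⟩ := hagree v hv
      exact ⟨w, hw, funext fun a => hwv _ (heS a)⟩
    refine hW _ e hS {f | ∃ v, cylInd U S v ∉ juntaSpan d U ∧ f = v ∘ e}
      ((U.finite_toSet.image _).subset hsub) ⟨_, v₀, hv₀, rfl⟩ (hsub.trans (Set.image_mono hU)) ?_
    rintro _ ⟨v, hv, rfl⟩ a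
    obtain ⟨w, hw, hwv⟩ := hagree v hv
    have hmem : v (e a) ∈ U.image (fun w => w (e a)) :=
      Finset.mem_image.2 ⟨w, hw, hwv _ (heS a)⟩
    have hsum := cylInd_erase U (heS a) v
    rw [← Finset.add_sum_erase _ _ hmem, Function.update_eq_self] at hsum
    have : ∃ y, y ≠ v (e a) ∧ cylInd U S (Function.update v (e a) y) ∉ juntaSpan d U := by
      by_contra! hall
      refine hv ?_
      rw [← sub_eq_iff_eq_add] at hsum
      rw [← hsum]
      exact Submodule.sub_mem _ (ih _ (Finset.erase_ssubset (heS a)) v)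
        (Submodule.sum_mem _ fun y hy => hall y (Finset.ne_of_mem_erase hy))
    obtain ⟨y, hy, hyv⟩ := this
    refine ⟨_, ⟨_, hyv, rfl⟩, ?_, fun b hb => ?_⟩
    · simpa using hy.symm
    · have : e b ≠ e a := fun h => hb (e.injective h)
      simp [Function.update_of_ne this]

/-- With `S` the set of all coordinates, the indicators are the point masses. -/
lemma juntaSpan_eq_top {Y : Type*} {n d : ℕ} {W : Set (Fin n → Y)} (hW : PseudoCubeFree d W)
    {U : Finset (Fin n → Y)} (hU : (U : Set (Fin n → Y)) ⊆ W) : juntaSpan d U = ⊤ := by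
  classical
  rw [eq_top_iff, ← (Pi.basisFun ℚ U).span_eq, Submodule.span_le]
  rintro _ ⟨u, rfl⟩
  have : Pi.basisFun ℚ U u = cylInd U Finset.univ u.1 := by
    funext w
    rw [cylInd_apply (p := w = u) (by rw [Subtype.ext_iff, funext_iff]; simp), Pi.basisFun_apply,
      Pi.single_apply]
  rw [this]
  exact cylInd_mem_juntaSpan hW hU _ _

open Classical in
/-- The density bound: the one-inclusion graph of a finite set without pseudo-cubes of dimension
more than `d` has at least `(n - d) * |U|` edges. -/
lemma card_mul_le_sum_card_image_off {Y : Type*} {n d : ℕ} {W : Set (Fin n → Y)}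
    (hW : PseudoCubeFree d W) {U : Finset (Fin n → Y)} (hU : (U : Set (Fin n → Y)) ⊆ W) :
    U.card * (n - d) ≤ ∑ i : Fin n, (U.image (off i)).card := by
  obtain ⟨b, hb, hspan, hli⟩ := exists_linearIndependent ℚ
    {f | ∃ S : Finset (Fin n), S.card ≤ d ∧ ∃ v, f = cylInd U S v}
  have hfin : b.Finite := hli.setFinite
  have : Fintype b := hfin.fintype
  have hcard : Fintype.card b = U.card := by
    have hsp : ⊤ ≤ Submodule.span ℚ (Set.range (Subtype.val : b → U → ℚ)) := by
      rw [Subtype.range_coe, hspan]; exact (juntaSpan_eq_top hW hU).ge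
    have := Module.finrank_eq_card_basis (Module.Basis.mk hli hsp)
    rw [← this]; simp
  choose S hS v hv using fun f : b => hb f.2
  -- Basis elements that do not read the coordinate `i` factor through `off i`, so they are
  -- independent in a space whose dimension is the number of edges in direction `i`.
  have hdir : ∀ i : Fin n, (Finset.univ.filter fun f : b => i ∉ S f).card ≤
      (U.image (off i)).card := by
    intro i
    let L : (U.image (off i) → ℚ) →ₗ[ℚ] (U → ℚ) :=
      LinearMap.funLeft ℚ ℚ fun w => ⟨off i w.1, Finset.mem_image_of_mem _ w.2⟩
    have hmem : ∀ f : {f : b // i ∉ S f}, (f.1.1 : U → ℚ) ∈ LinearMap.range L := by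
      intro f
      have hfac : ∃ g : U.image (off i) → ℚ, ∀ w : U, f.1.1 w =
          g ⟨off i w.1, Finset.mem_image_of_mem _ w.2⟩ := by
        refine ⟨fun z => if ∀ j (hj : j ≠ i), j ∈ S f.1 → z.1 ⟨j, hj⟩ = v f.1 j then 1 else 0,
          fun w => ?_⟩
        have hiff : (∀ j ∈ S f.1, w.1 j = v f.1 j) ↔
            ∀ j (_ : j ≠ i), j ∈ S f.1 → w.1 j = v f.1 j :=
          ⟨fun h j _ hj => h j hj, fun h j hj => h j (fun hji => f.2 (hji ▸ hj)) hj⟩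
        rw [hv f.1, cylInd_apply hiff]
        rfl
      obtain ⟨g, hg⟩ := hfac
      exact ⟨g, funext fun w => (hg w).symm⟩
    have hli' : LinearIndependent ℚ fun f : {f : b // i ∉ S f} => (⟨f.1.1, hmem f⟩ :
        LinearMap.range L) := by
      apply LinearIndependent.of_comp (LinearMap.range L).subtype
      exact hli.comp _ Subtype.val_injective
    have h1 := hli'.fintype_card_le_finrank
    have h2 := LinearMap.finrank_range_le L
    rw [Fintype.card_subtype] at h1
    refine h1.trans (h2.trans ?_)
    simp
  -- Double counting: each of the `|U|` basis elements ignores at least `n - d` coordinates.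
  calc U.card * (n - d) = ∑ _f : b, (n - d) := by simp [hcard]
    _ ≤ ∑ f : b, (Finset.univ.filter fun i => i ∉ S f).card := by
        refine Finset.sum_le_sum fun f _ => ?_
        have : (Finset.univ.filter fun i => i ∉ S f) = (S f)ᶜ := by ext; simp
        rw [this, Finset.card_compl, Fintype.card_fin]
        exact Nat.sub_le_sub_left (hS f) n
    _ = ∑ i : Fin n, (Finset.univ.filter fun f : b => i ∉ S f).card := by
        simp only [Finset.card_filter]
        exact Finset.sum_comm
    _ ≤ _ := Finset.sum_le_sum fun i _ => hdir i

/-! ### Selections of edges -/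

/-- Each vertex `w` of `W` selects the edges in the directions `i` with `T (w, i) = true`. It
selects all but at most `r` of its edges, and no edge is selected by two vertices. -/
def IsSelection {Y : Type*} {n : ℕ} (r : ℕ) (W : Set (Fin n → Y))
    (T : (Fin n → Y) × Fin n → Bool) : Prop :=
  ∀ w ∈ W, {i | T (w, i) = false}.ncard ≤ r ∧
    ∀ w' ∈ W, ∀ i, off i w = off i w' → T (w, i) = true → T (w', i) = true → w = w'

open Classical in
/-- By Hall's theorem, the density bound yields a selection. -/
lemma PseudoCubeFree.exists_isSelection {Y : Type*} {n d : ℕ} {W : Set (Fin n → Y)}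
    (hW : PseudoCubeFree d W) : ∃ T, IsSelection d W T := by
  -- Each vertex enters in `n - d` copies, one for each edge that it has to select.
  let t : W × Fin (n - d) → Finset (Σ i : Fin n, ({j : Fin n // j ≠ i} → Y)) :=
    fun p => Finset.univ.image fun i => ⟨i, off i p.1.1⟩
  have hall : ∀ s : Finset (W × Fin (n - d)), s.card ≤ (s.biUnion t).card := by
    intro s
    let U : Finset (Fin n → Y) := s.image fun p => p.1.1
    have hU : (U : Set (Fin n → Y)) ⊆ W := by
      intro w hw
      obtain ⟨p, -, rfl⟩ := Finset.mem_image.1 (Finset.mem_coe.1 hw)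
      exact p.1.2
    have h1 : s.card ≤ (U ×ˢ (Finset.univ : Finset (Fin (n - d)))).card := by
      refine Finset.card_le_card_of_injOn (fun p => (p.1.1, p.2)) (fun p hp => ?_) ?_
      · exact Finset.mem_coe.2 (Finset.mem_product.2
          ⟨Finset.mem_image_of_mem _ hp, Finset.mem_univ _⟩)
      · rintro ⟨⟨a, ha⟩, b⟩ - ⟨⟨a', ha'⟩, b'⟩ - h
        simpa using h
    have h2 : (Finset.univ.sigma fun i => U.image (off i)) ⊆ s.biUnion t := by
      rintro ⟨i, f⟩ h
      obtain ⟨w, hw, hwf⟩ := Finset.mem_image.1 (Finset.mem_sigma.1 h).2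
      obtain rfl : off i w = f := hwf
      obtain ⟨p, hp, rfl⟩ := Finset.mem_image.1 hw
      exact Finset.mem_biUnion.2 ⟨p, hp, Finset.mem_image.2 ⟨i, Finset.mem_univ _, rfl⟩⟩
    have h3 := Finset.card_le_card h2
    rw [Finset.card_sigma] at h3
    rw [Finset.card_product, Finset.card_univ, Fintype.card_fin] at h1
    exact h1.trans ((card_mul_le_sum_card_image_off hW hU).trans h3)
  -- Hall's theorem for possibly infinite families of finite sets: testing finite subfamilies
  -- suffices, so `W` may be infinite.
  obtain ⟨φ, hφ, hmem⟩ := (Finset.all_card_le_biUnion_card_iff_exists_injective t).1 hall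
  refine ⟨fun p => decide (∃ (h : p.1 ∈ W) (j : Fin (n - d)), φ (⟨p.1, h⟩, j) = ⟨p.2, off p.2 p.1⟩),
    fun w hw => ⟨?_, ?_⟩⟩
  · have hdir : ∀ j, φ (⟨w, hw⟩, j) = ⟨(φ (⟨w, hw⟩, j)).1, off _ w⟩ := by
      intro j
      obtain ⟨i, -, hi⟩ := Finset.mem_image.1 (hmem (⟨w, hw⟩, j))
      rw [← hi]
    have hinj : Function.Injective fun j => (φ (⟨w, hw⟩, j)).1 := by
      intro j j' hjj
      have : φ (⟨w, hw⟩, j) = φ (⟨w, hw⟩, j') := by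
        rw [hdir j, hdir j']
        simp only at hjj
        rw [hjj]
      simpa using hφ this
    have hsub : {i | decide (∃ (h : w ∈ W) (j : Fin (n - d)), φ (⟨w, h⟩, j) = ⟨i, off i w⟩) = false} ⊆
        ((Finset.univ.image fun j => (φ (⟨w, hw⟩, j)).1)ᶜ : Finset (Fin n)) := by
      intro i hi
      rw [Finset.mem_coe, Finset.mem_compl]
      intro h
      obtain ⟨j, -, rfl⟩ := Finset.mem_image.1 h
      have := of_decide_eq_false hi
      exact this ⟨hw, j, hdir j⟩
    have := Set.ncard_le_ncard hsub (Finset.finite_toSet _)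
    rw [Set.ncard_coe_finset, Finset.card_compl, Finset.card_image_of_injective _ hinj,
      Finset.card_univ, Fintype.card_fin, Fintype.card_fin] at this
    exact this.trans (by omega)
  · intro w' hw' i hoff h1 h2
    obtain ⟨_, j, hj⟩ := of_decide_eq_true h1
    obtain ⟨_, j', hj'⟩ := of_decide_eq_true h2
    simp only at hj hj'
    rw [← hoff, ← hj] at hj'
    have := hφ hj'
    simp only [Prod.mk.injEq, Subtype.mk.injEq] at this
    exact this.1.symm

/-- Each vertex selects the edges mapped to it, so no orientation beats the best selection. -/
lemma isSelection_of_outdeg_le {Y : Type*} {n r : ℕ} {W : Set (Fin n → Y)} {σ : EdgeMap Y n}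
    (hr : ∀ w ∈ W, outdeg σ w ≤ r) [DecidableEq (Fin n → Y)] :
    IsSelection r W fun p => decide (σ p.2 (off p.2 p.1) = p.1) := by
  refine fun w hw => ⟨?_, fun w' hw' i hoff h1 h2 => ?_⟩
  · simpa [outdeg] using hr w hw
  · have h1 := of_decide_eq_true h1
    have h2 := of_decide_eq_true h2
    simp only at h1 h2
    rw [← h1, hoff, h2]

/-! ### Measurable selection of lexicographically extreme points -/

open Classical in
/-- The lexicographically largest element of a compact set of bit sequences. -/
noncomputable def lexMax (Q : Set (ℕ → Bool)) : ℕ → Bool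
  | j => decide (∃ t ∈ Q, (∀ i : Fin j, t i = lexMax Q i) ∧ t j = true)
  termination_by j => j
  decreasing_by exact i.2

-- Only finite prefixes are matched. The limit itself lies in `Q` only under closedness, which is
-- not assumed here.
open Classical in
lemma exists_mem_eq_lexMax {Q : Set (ℕ → Bool)} (hQ : Q.Nonempty) (j : ℕ) :
    ∃ t ∈ Q, ∀ i : Fin j, t i = lexMax Q i := by
  induction j with
  | zero => exact ⟨hQ.some, hQ.some_mem, fun i => i.elim0⟩
  | succ j ih =>
    by_cases h : ∃ t ∈ Q, (∀ i : Fin j, t i = lexMax Q i) ∧ t j = true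
    · obtain ⟨t, ht, hlt, hj⟩ := h
      refine ⟨t, ht, Fin.lastCases ?_ fun i => hlt i⟩
      rw [lexMax]
      simp only [Fin.val_last, hj]
      exact (decide_eq_true ⟨t, ht, hlt, hj⟩).symm
    · obtain ⟨t, ht, hlt⟩ := ih
      refine ⟨t, ht, Fin.lastCases ?_ fun i => hlt i⟩
      rw [lexMax]
      simp only [Fin.val_last]
      rw [decide_eq_false h]
      by_contra hne
      exact h ⟨t, ht, hlt, by simpa using hne⟩

/-- Each constraint reads finitely many bits, so it passes from a member that agrees with the
maximum on these bits. -/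
lemma lexMax_spec {κ : Type*} {C : κ → (ℕ → Bool) → Prop} {N : κ → ℕ}
    (hC : ∀ k t t', (∀ i < N k, t i = t' i) → C k t → C k t') (hne : ∃ t, ∀ k, C k t) (k : κ) :
    C k (lexMax {t | ∀ k, C k t}) := by
  obtain ⟨t, ht, hlt⟩ := exists_mem_eq_lexMax (Q := {t | ∀ k, C k t}) hne (N k)
  exact hC k t _ (fun i hi => hlt ⟨i, hi⟩) (ht k)

/-- Compactness of the Cantor space: constraints on finitely many bits are closed, and the finite
subfamilies are directed. This trades an existential over uncountably many `t` for finite problems.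
-/
lemma exists_forall_iff_finset {κ : Type*} {C : κ → (ℕ → Bool) → Prop} {N : κ → ℕ}
    (hC : ∀ k t t', (∀ i < N k, t i = t' i) → C k t → C k t') {j : ℕ} (p : Fin j → Bool) :
    (∃ t, (∀ k, C k t) ∧ ∀ i : Fin j, t i = p i) ↔
      ∀ K : Finset κ, ∃ t, (∀ k ∈ K, C k t) ∧ ∀ i : Fin j, t i = p i := by
  classical
  refine ⟨fun ⟨t, h1, h2⟩ K => ⟨t, fun k _ => h1 k, h2⟩, fun h => ?_⟩
  have hcl : ∀ k, IsClosed {t : ℕ → Bool | C k t} := by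
    intro k
    have : {t : ℕ → Bool | C k t} = (fun (t : ℕ → Bool) (i : Fin (N k)) => t i) ⁻¹'
        ((fun (t : ℕ → Bool) (i : Fin (N k)) => t i) '' {t | C k t}) := by
      refine (Set.subset_preimage_image _ _).antisymm ?_
      rintro t ⟨t', ht', heq⟩
      exact hC k t' t (fun i hi => congrFun heq ⟨i, hi⟩) ht'
    rw [this]
    exact (isClosed_discrete _).preimage (by fun_prop)
  have hclp : IsClosed {t : ℕ → Bool | ∀ i : Fin j, t i = p i} := by
    simp only [Set.ofPred_forall]
    exact isClosed_iInter fun i => isClosed_eq (continuous_apply _) continuous_const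
  have hclK : ∀ K : Finset κ,
      IsClosed {t : ℕ → Bool | (∀ k ∈ K, C k t) ∧ ∀ i : Fin j, t i = p i} := by
    intro K
    refine IsClosed.inter (s₁ := {t : ℕ → Bool | ∀ k ∈ K, C k t}) ?_ hclp
    simp only [Set.ofPred_forall]
    exact isClosed_biInter fun k _ => hcl k
  obtain ⟨t, ht⟩ := IsCompact.nonempty_iInter_of_directed_nonempty_isCompact_isClosed
    (fun K : Finset κ => {t : ℕ → Bool | (∀ k ∈ K, C k t) ∧ ∀ i : Fin j, t i = p i})
    (fun K K' => ⟨K ∪ K',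
      fun t ht => ⟨fun k hk => ht.1 k (Finset.mem_union_left _ hk), ht.2⟩,
      fun t ht => ⟨fun k hk => ht.1 k (Finset.mem_union_right _ hk), ht.2⟩⟩)
    h (fun K => (hclK K).isCompact) hclK
  rw [Set.mem_iInter] at ht
  exact ⟨t, fun k => (ht {k}).1 k (Finset.mem_singleton_self k), (ht ∅).2⟩

section
variable {Ω κ : Type*} [MeasurableSpace Ω] [Countable κ] {C : Ω → κ → (ℕ → Bool) → Prop}
  {N : κ → ℕ}

/-- There are countably many finite `K`, and for each of them only the first `M` bits matter, so `t`
ranges over finitely many prefixes. -/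
lemma measurableSet_exists_forall
    (hC : ∀ ω k t t', (∀ i < N k, t i = t' i) → C ω k t → C ω k t')
    (hm : ∀ k t, MeasurableSet {ω | C ω k t}) {j : ℕ} (p : Fin j → Bool) :
    MeasurableSet {ω | ∃ t, (∀ k, C ω k t) ∧ ∀ i : Fin j, t i = p i} := by
  classical
  simp only [fun ω => exists_forall_iff_finset (hC ω) p, Set.ofPred_forall]
  refine MeasurableSet.iInter fun K => ?_
  let M := max j (K.sup N)
  -- The padding by `false` is harmless, as neither the constraints in `K` nor `p` read past `M`.
  let ext : (Fin M → Bool) → ℕ → Bool := fun q i => if h : i < M then q ⟨i, h⟩ else false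
  have hext : ∀ (t : ℕ → Bool), ∀ i < M, t i = ext (fun i => t i) i := fun t i hi => by
    simp [ext, hi]
  have : {ω | ∃ t, (∀ k ∈ K, C ω k t) ∧ ∀ i : Fin j, t i = p i} =
      ⋃ q : Fin M → Bool, (⋂ k ∈ K, {ω | C ω k (ext q)}) ∩ {_ω | ∀ i : Fin j, ext q i = p i} := by
    ext ω
    simp only [Set.mem_ofPred_eq, Set.mem_iUnion, Set.mem_inter_iff, Set.mem_iInter]
    constructor
    · rintro ⟨t, h1, h2⟩
      refine ⟨fun i => t i, fun k hk => hC ω k t _ (fun i hi => hext t i ?_) (h1 k hk),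
        fun i => ?_⟩
      · exact hi.trans_le ((Finset.le_sup hk).trans (le_max_right _ _))
      · rw [← hext t i (i.2.trans_le (le_max_left _ _)), h2]
    · rintro ⟨q, h1, h2⟩
      exact ⟨ext q, h1, h2⟩
  rw [this]
  exact MeasurableSet.iUnion fun q => MeasurableSet.inter
    (MeasurableSet.biInter K.countable_toSet fun k _ => hm k _) (MeasurableSet.const _)

/-- Induction on the bit: for each of the finitely many values of the earlier bits, the defining
condition is an existence statement with a prescribed prefix. -/
lemma measurableSet_lexMax_eq
    (hC : ∀ ω k t t', (∀ i < N k, t i = t' i) → C ω k t → C ω k t')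
    (hm : ∀ k t, MeasurableSet {ω | C ω k t}) (j : ℕ) (b : Bool) :
    MeasurableSet {ω | lexMax {t | ∀ k, C ω k t} j = b} := by
  classical
  induction j using Nat.strong_induction_on generalizing b with
  | _ j ih =>
    have htrue : {ω | lexMax {t | ∀ k, C ω k t} j = true} =
        ⋃ p : Fin j → Bool, (⋂ i : Fin j, {ω | lexMax {t | ∀ k, C ω k t} i = p i}) ∩
          {ω | ∃ t, (∀ k, C ω k t) ∧
            ∀ i : Fin (j + 1), t i = Fin.snoc (α := fun _ => Bool) p true i} := by
      ext ω
      rw [Set.mem_ofPred_eq, lexMax, decide_eq_true_iff]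
      simp only [Set.mem_ofPred_eq, Set.mem_iUnion, Set.mem_inter_iff, Set.mem_iInter,
        Fin.forall_fin_succ', Fin.val_castSucc, Fin.snoc_castSucc, Fin.val_last, Fin.snoc_last]
      constructor
      · rintro ⟨t, h1, h2, h3⟩
        exact ⟨fun i => lexMax _ i, fun i => rfl, t, h1, h2, h3⟩
      · rintro ⟨p, hp, t, h1, h2, h3⟩
        exact ⟨t, h1, fun i => by rw [h2, hp], h3⟩
    have hT : MeasurableSet {ω | lexMax {t | ∀ k, C ω k t} j = true} := by
      rw [htrue]
      exact MeasurableSet.iUnion fun p => MeasurableSet.inter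
        (MeasurableSet.iInter fun i => ih i i.2 _) (measurableSet_exists_forall hC hm _)
    cases b
    · have : {ω | lexMax {t | ∀ k, C ω k t} j = false} =
          {ω | lexMax {t | ∀ k, C ω k t} j = true}ᶜ := by ext; simp
      rw [this]; exact hT.compl
    · exact hT
end

lemma measurableSet_setOf_forall {Ω ι : Type*} [MeasurableSpace Ω] [Countable ι]
    {p : ι → Ω → Prop} (h : ∀ i, MeasurableSet {ω | p i ω}) : MeasurableSet {ω | ∀ i, p i ω} := by
  rw [Set.ofPred_forall]
  exact MeasurableSet.iInter h

/-- An injective numbering of a countable type. -/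
noncomputable def natCode (V : Type*) [Countable V] : V → ℕ := (exists_injective_nat V).choose

lemma natCode_injective (V : Type*) [Countable V] : Function.Injective (natCode V) :=
  (exists_injective_nat V).choose_spec

open Classical in
/-- The element of `A` with the smallest number. -/
noncomputable def firstMem {V : Type*} [Countable V] [Nonempty V] (A : Set V) : V :=
  if h : A.Nonempty then Function.argminOn (natCode V) A h else Classical.arbitrary V

lemma firstMem_mem {V : Type*} [Countable V] [Nonempty V] {A : Set V} (h : A.Nonempty) :
    firstMem A ∈ A := by
  rw [firstMem, dif_pos h]
  exact Function.argminOn_mem _ _ _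

/-- The right-hand side involves only countably many membership statements, which is the form that
measurability needs. -/
lemma firstMem_eq_iff {V : Type*} [Countable V] [Nonempty V] {A : Set V} {v : V} :
    firstMem A = v ↔ (v ∈ A ∧ ∀ u, u ∈ A → natCode V v ≤ natCode V u) ∨
      ((∀ u, u ∉ A) ∧ Classical.arbitrary V = v) := by
  by_cases h : A.Nonempty
  · have h' : ¬ ∀ u, u ∉ A := fun hn => hn _ h.some_mem
    simp only [h', false_and, or_false]
    have hmin : ∀ u ∈ A, natCode V (firstMem A) ≤ natCode V u := by
      intro u hu
      rw [firstMem, dif_pos h]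
      exact Function.argminOn_le (natCode V) A hu
    constructor
    · rintro rfl
      exact ⟨firstMem_mem h, hmin⟩
    · rintro ⟨hv, hle⟩
      exact natCode_injective V (le_antisymm (hmin v hv) (hle _ (firstMem_mem h)))
  · have h' : ∀ u, u ∉ A := fun u hu => h ⟨u, hu⟩
    simp only [h', not_false_eq_true, implies_true, true_and, false_and, false_or]
    rw [firstMem, dif_neg h]

lemma measurableSet_firstMem_eq {Ω V : Type*} [MeasurableSpace Ω] [Countable V] [Nonempty V]
    {A : Ω → Set V} (hA : ∀ v, MeasurableSet {ω | v ∈ A ω}) (v : V) :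
    MeasurableSet {ω | firstMem (A ω) = v} := by
  simp only [firstMem_eq_iff]
  have h1 : MeasurableSet {ω | ∀ u, u ∈ A ω → natCode V v ≤ natCode V u} :=
    measurableSet_setOf_forall fun u => (hA u).imp (MeasurableSet.const _)
  have h2 : MeasurableSet {ω | ∀ u, u ∉ A ω} := measurableSet_setOf_forall fun u => (hA u).compl
  exact ((hA v).inter h1).union (h2.inter (MeasurableSet.const _))

/-! ### A measurable choice of optimal orientations -/

section
variable {Y : Type*} {n : ℕ}

/-- The smallest possible maximum out-degree. -/
noncomputable def optRank (W : Set (Fin n → Y)) : ℕ := sInf {r | ∃ T, IsSelection r W T}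

lemma exists_isSelection_self (W : Set (Fin n → Y)) : ∃ T, IsSelection n W T := by
  refine ⟨fun _ => false, fun w _ => ⟨?_, fun _ _ _ _ h => by simp at h⟩⟩
  simp

lemma exists_isSelection_optRank (W : Set (Fin n → Y)) : ∃ T, IsSelection (optRank W) W T :=
  Nat.sInf_mem (s := {r | ∃ T, IsSelection r W T}) ⟨n, exists_isSelection_self W⟩

lemma optRank_le {W : Set (Fin n → Y)} {r : ℕ} (h : ∃ T, IsSelection r W T) : optRank W ≤ r :=
  Nat.sInf_le h

variable [Countable Y]

/-- The part of `IsSelection` that concerns the pair `k` of vertices, for encoded selections. -/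
def SelectionConstraint (r : ℕ) (W : Set (Fin n → Y)) (k : (Fin n → Y) × (Fin n → Y))
    (t : ℕ → Bool) : Prop :=
  k.1 ∈ W → {i | t (natCode ((Fin n → Y) × Fin n) (k.1, i)) = false}.ncard ≤ r ∧
    (k.2 ∈ W → ∀ i, off i k.1 = off i k.2 → t (natCode ((Fin n → Y) × Fin n) (k.1, i)) = true →
      t (natCode ((Fin n → Y) × Fin n) (k.2, i)) = true → k.1 = k.2)

lemma forall_selectionConstraint_iff {r : ℕ} {W : Set (Fin n → Y)} {t : ℕ → Bool} :
    (∀ k, SelectionConstraint r W k t) ↔ IsSelection r W (t ∘ natCode ((Fin n → Y) × Fin n)) := by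
  constructor
  · intro h w hw
    exact ⟨(h (w, w) hw).1, fun w' hw' => (h (w, w') hw).2 hw'⟩
  · intro h k (hk : k.1 ∈ W)
    exact ⟨(h k.1 hk).1, fun hk' => (h k.1 hk).2 k.2 hk'⟩

/-- A bound for the bits on which the constraint of the pair `k` depends. -/
noncomputable def constraintBound (k : (Fin n → Y) × (Fin n → Y)) : ℕ :=
  (Finset.univ : Finset (Fin n)).sup fun i => max (natCode ((Fin n → Y) × Fin n) (k.1, i) + 1) (natCode ((Fin n → Y) × Fin n) (k.2, i) + 1)

lemma SelectionConstraint.congr {r : ℕ} {W : Set (Fin n → Y)} (k : (Fin n → Y) × (Fin n → Y))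
    (t t' : ℕ → Bool) (h : ∀ i < constraintBound k, t i = t' i)
    (ht : SelectionConstraint r W k t) : SelectionConstraint r W k t' := by
  have h1 : ∀ i, t (natCode ((Fin n → Y) × Fin n) (k.1, i)) = t' (natCode ((Fin n → Y) × Fin n) (k.1, i)) := fun i => h _ <| by
    have := Finset.le_sup (f := fun i => max (natCode ((Fin n → Y) × Fin n) (k.1, i) + 1) (natCode ((Fin n → Y) × Fin n) (k.2, i) + 1))
      (Finset.mem_univ i)
    exact lt_of_lt_of_le (by simp) this
  have h2 : ∀ i, t (natCode ((Fin n → Y) × Fin n) (k.2, i)) = t' (natCode ((Fin n → Y) × Fin n) (k.2, i)) := fun i => h _ <| by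
    have := Finset.le_sup (f := fun i => max (natCode ((Fin n → Y) × Fin n) (k.1, i) + 1) (natCode ((Fin n → Y) × Fin n) (k.2, i) + 1))
      (Finset.mem_univ i)
    exact lt_of_lt_of_le (by simp) this
  simpa only [SelectionConstraint, h1, h2] using ht

lemma exists_isSelection_iff {r : ℕ} {W : Set (Fin n → Y)} :
    (∃ T, IsSelection r W T) ↔ ∃ t, ∀ k, SelectionConstraint r W k t := by
  simp only [forall_selectionConstraint_iff]
  constructor
  · rintro ⟨T, hT⟩
    -- Bits outside the range of the numbering are free.
    refine ⟨Function.extend (natCode _) T fun _ => false, ?_⟩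
    rwa [Function.extend_comp (natCode_injective _)]
  · rintro ⟨t, ht⟩
    exact ⟨_, ht⟩

/-- A canonical selection of minimal rank. -/
noncomputable def optSelection (W : Set (Fin n → Y)) : (Fin n → Y) × Fin n → Bool :=
  lexMax {t | ∀ k, SelectionConstraint (optRank W) W k t} ∘ natCode _

lemma isSelection_optSelection (W : Set (Fin n → Y)) :
    IsSelection (optRank W) W (optSelection W) :=
  forall_selectionConstraint_iff.1 fun k =>
    lexMax_spec (N := constraintBound) (fun k t t' => SelectionConstraint.congr k t t')
      (exists_isSelection_iff.1 (exists_isSelection_optRank W)) k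

/-- The vertices to which the edge may be oriented. -/
def edgeTargets (W : Set (Fin n → Y)) (i : Fin n) (f : {j : Fin n // j ≠ i} → Y) :
    Set (Fin n → Y) :=
  {w | w ∈ oigEdge W i f ∧
    (optSelection W (w, i) = true ∨ ∀ u, ¬ (u ∈ oigEdge W i f ∧ optSelection W (u, i) = true))}

/-- A canonical optimal orientation. -/
noncomputable def optOrientation [Nonempty Y] (W : Set (Fin n → Y)) : EdgeMap Y n := fun i f =>
  firstMem (edgeTargets W i f)

lemma optOrientation_mem [Nonempty Y] {W : Set (Fin n → Y)} {i : Fin n} {f : {j : Fin n // j ≠ i} → Y}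
    (h : (oigEdge W i f).Nonempty) : optOrientation W i f ∈ edgeTargets W i f := by
  refine firstMem_mem ?_
  by_cases hs : ∃ u, u ∈ oigEdge W i f ∧ optSelection W (u, i) = true
  · obtain ⟨u, hu, hu'⟩ := hs
    exact ⟨u, hu, Or.inl hu'⟩
  · obtain ⟨u, hu⟩ := h
    exact ⟨u, hu, Or.inr (not_exists.1 hs)⟩

lemma isOrientation_optOrientation [Nonempty Y] (W : Set (Fin n → Y)) : IsOrientation W (optOrientation W) :=
  fun _ _ h => (optOrientation_mem h).1

/-- A vertex that selects an edge is the only one to do so, hence the edge is mapped to it. Only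
unselected edges can be lost. -/
lemma outdeg_optOrientation_le [Nonempty Y] {W : Set (Fin n → Y)} {w : Fin n → Y} (hw : w ∈ W) :
    outdeg (optOrientation W) w ≤ optRank W := by
  refine (Set.ncard_le_ncard ?_ (Set.toFinite _)).trans (isSelection_optSelection W w hw).1
  intro i hi
  by_contra hT
  have hT : optSelection W (w, i) = true := by simpa using hT
  have hmem : w ∈ oigEdge W i (off i w) := ⟨hw, rfl⟩
  obtain ⟨⟨h1, h2⟩, h3⟩ := optOrientation_mem ⟨w, hmem⟩
  have h3 := h3.resolve_right fun h => h w ⟨hmem, hT⟩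
  exact hi ((isSelection_optSelection W _ h1).2 w hw i h2 h3 hT)

lemma isOptimalOrientation_optOrientation [Nonempty Y] (W : Set (Fin n → Y)) :
    IsOptimalOrientation W (optOrientation W) := by
  classical
  exact ⟨isOrientation_optOrientation W, fun σ' _ r hr w hw =>
    (outdeg_optOrientation_le hw).trans (optRank_le ⟨_, isSelection_of_outdeg_le hr⟩)⟩

lemma PseudoCubeFree.outdeg_optOrientation_le [Nonempty Y] {d : ℕ} {W : Set (Fin n → Y)}
    (hW : PseudoCubeFree d W) {w : Fin n → Y} (hw : w ∈ W) : outdeg (optOrientation W) w ≤ d :=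
  (_root_.outdeg_optOrientation_le hw).trans (optRank_le hW.exists_isSelection)

variable {Ω : Type*} [MeasurableSpace Ω] {W : Ω → Set (Fin n → Y)}

lemma measurableSet_selectionConstraint (hW : ∀ v, MeasurableSet {ω | v ∈ W ω}) (r : ℕ)
    (k : (Fin n → Y) × (Fin n → Y)) (t : ℕ → Bool) :
    MeasurableSet {ω | SelectionConstraint r (W ω) k t} := by
  unfold SelectionConstraint
  exact (hW k.1).imp ((MeasurableSet.const _).inter ((hW k.2).imp (MeasurableSet.const _)))

lemma measurableSet_optRank_eq (hW : ∀ v, MeasurableSet {ω | v ∈ W ω}) (r : ℕ) :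
    MeasurableSet {ω | optRank (W ω) = r} := by
  have hex : ∀ r, MeasurableSet {ω | ∃ T, IsSelection r (W ω) T} := by
    intro r
    -- The empty prefix, `j = 0`, leaves plain existence.
    have := measurableSet_exists_forall (C := fun ω => SelectionConstraint r (W ω))
      (N := constraintBound) (fun ω k t t' => SelectionConstraint.congr k t t')
      (measurableSet_selectionConstraint hW r) (j := 0) Fin.elim0
    simp only [exists_isSelection_iff]
    convert this using 5
    simp
  have : {ω | optRank (W ω) = r} = {ω | ∃ T, IsSelection r (W ω) T} ∩
      ⋂ s : Fin r, {ω | ∃ T, IsSelection s (W ω) T}ᶜ := by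
    ext ω
    simp only [Set.mem_ofPred_eq, Set.mem_inter_iff, Set.mem_iInter, Set.mem_compl_iff]
    constructor
    · rintro rfl
      exact ⟨exists_isSelection_optRank _, fun s hs => absurd (optRank_le hs) (not_le.2 s.2)⟩
    · rintro ⟨h1, h2⟩
      refine le_antisymm (optRank_le h1) (not_lt.1 fun hlt => ?_)
      exact h2 ⟨_, hlt⟩ (exists_isSelection_optRank _)
  rw [this]
  exact (hex r).inter (MeasurableSet.iInter fun s => (hex s).compl)

/-- The constraints depend on the optimal rank, so the event is split according to its value. -/
lemma measurableSet_optSelection (hW : ∀ v, MeasurableSet {ω | v ∈ W ω})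
    (p : (Fin n → Y) × Fin n) : MeasurableSet {ω | optSelection (W ω) p = true} := by
  have : {ω | optSelection (W ω) p = true} = ⋃ r, {ω | optRank (W ω) = r} ∩
      {ω | lexMax {t | ∀ k, SelectionConstraint r (W ω) k t} (natCode _ p) = true} := by
    ext ω
    simp [optSelection]
  rw [this]
  exact MeasurableSet.iUnion fun r => (measurableSet_optRank_eq hW r).inter
    (measurableSet_lexMax_eq (C := fun ω => SelectionConstraint r (W ω))
      (N := constraintBound) (fun ω k t t' => SelectionConstraint.congr k t t')
      (measurableSet_selectionConstraint hW r) _ _)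

lemma measurableSet_optOrientation_eq [Nonempty Y] (hW : ∀ v, MeasurableSet {ω | v ∈ W ω}) (i : Fin n)
    (f : {j : Fin n // j ≠ i} → Y) (v : Fin n → Y) :
    MeasurableSet {ω | optOrientation (W ω) i f = v} := by
  have hedge : ∀ u, MeasurableSet {ω | u ∈ oigEdge (W ω) i f} := fun u =>
    (hW u).inter (MeasurableSet.const _)
  refine measurableSet_firstMem_eq (fun u => ?_) v
  have h : MeasurableSet
      {ω | ∀ u, ¬ (u ∈ oigEdge (W ω) i f ∧ optSelection (W ω) (u, i) = true)} :=
    measurableSet_setOf_forall fun u => ((hedge u).inter (measurableSet_optSelection hW _)).compl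
  exact (hedge u).inter ((measurableSet_optSelection hW _).union h)
end

/-! ### Orientations that do not depend on the order of the points -/

/-- Reordering the coordinates of an orientation. -/
def EdgeMap.reorder {Y : Type*} {n : ℕ} (s : Equiv.Perm (Fin n)) (σ : EdgeMap Y n) :
    EdgeMap Y n := fun i f =>
  σ (s.symm i) (fun j => f ⟨s j, fun h => j.2 (s.eq_symm_apply.2 h)⟩) ∘ s.symm

lemma EdgeMap.reorder_off {Y : Type*} {n : ℕ} (s : Equiv.Perm (Fin n)) (σ : EdgeMap Y n)
    (i : Fin n) (w : Fin n → Y) :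
    σ.reorder s i (off i w) = σ (s.symm i) (off (s.symm i) (w ∘ s)) ∘ s.symm := rfl

lemma comp_perm_comp_symm {n : ℕ} {Y : Type*} (s : Equiv.Perm (Fin n)) (w : Fin n → Y) :
    (w ∘ s) ∘ s.symm = w := by
  funext i; simp

lemma comp_symm_comp_perm {n : ℕ} {Y : Type*} (s : Equiv.Perm (Fin n)) (w : Fin n → Y) :
    (w ∘ s.symm) ∘ s = w := by
  funext i; simp

lemma outdeg_reorder {Y : Type*} {n : ℕ} (s : Equiv.Perm (Fin n)) (σ : EdgeMap Y n)
    (w : Fin n → Y) : outdeg (σ.reorder s) w = outdeg σ (w ∘ s) := by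
  have : {i | σ.reorder s i (off i w) ≠ w} = s '' {i | σ i (off i (w ∘ s)) ≠ w ∘ s} := by
    ext i
    rw [Set.mem_image_equiv]
    simp only [Set.mem_ofPred_eq, EdgeMap.reorder_off, ne_eq, not_iff_not]
    constructor
    · intro h
      conv_rhs => rw [← h]
      rw [comp_symm_comp_perm]
    · intro h
      rw [h, comp_perm_comp_symm]
  rw [outdeg, this, Set.ncard_image_of_injective _ s.injective, outdeg]

lemma IsOrientation.reorder {Y : Type*} {n : ℕ} {s : Equiv.Perm (Fin n)} {σ : EdgeMap Y n}
    {W W' : Set (Fin n → Y)} (hW : ∀ w, w ∈ W ↔ w ∘ s ∈ W') (h : IsOrientation W' σ) :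
    IsOrientation W (σ.reorder s) := by
  rintro i _ ⟨w, hw, rfl⟩
  obtain ⟨h1, h2⟩ := h (s.symm i) (off (s.symm i) (w ∘ s)) ⟨w ∘ s, (hW w).1 hw, rfl⟩
  rw [EdgeMap.reorder_off]
  refine ⟨(hW _).2 (by rwa [comp_symm_comp_perm]), funext fun j => ?_⟩
  have := congrFun h2 ⟨s.symm j, fun h => j.2 (s.symm.injective h)⟩
  simpa [off] using this

lemma IsOptimalOrientation.reorder {Y : Type*} {n : ℕ} {s : Equiv.Perm (Fin n)} {σ : EdgeMap Y n}
    {W W' : Set (Fin n → Y)} (hW : ∀ w, w ∈ W ↔ w ∘ s ∈ W') (h : IsOptimalOrientation W' σ) :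
    IsOptimalOrientation W (σ.reorder s) := by
  have hW' : ∀ w, w ∈ W' ↔ w ∘ s.symm ∈ W := fun w => by rw [hW, comp_symm_comp_perm]
  refine ⟨h.1.reorder hW, fun σ' hσ' r hr w hw => ?_⟩
  rw [outdeg_reorder]
  refine h.2 _ (hσ'.reorder hW') r (fun w' hw' => ?_) _ ((hW w).1 hw)
  rw [outdeg_reorder]
  exact hr _ ((hW' w').1 hw')

lemma comp_perm_mem_restrict {X Y : Type*} {H : Set (X → Y)} {n : ℕ} (s : Equiv.Perm (Fin n))
    (x : Fin n → X) (w : Fin n → Y) : w ∘ s ∈ restrict H (x ∘ s) ↔ w ∈ restrict H x := by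
  constructor
  · rintro ⟨h, hh, heq⟩
    refine ⟨h, hh, ?_⟩
    have := congrArg (· ∘ s.symm) heq
    simpa only [← Function.comp_assoc, comp_perm_comp_symm] using this
  · rintro ⟨h, hh, rfl⟩
    exact ⟨h, hh, rfl⟩

/-- If two coordinates carry the same point, then the edges in these directions are singletons. -/
lemma orientation_eq_of_point_eq {X Y : Type*} {H : Set (X → Y)} {n : ℕ} {z : Fin n → X} {σ : EdgeMap Y n}
    (hσ : IsOrientation (restrict H z) σ) {a b : Fin n} (hab : z a = z b) {v : Fin n → Y}
    (hv : v ∈ restrict H z) : σ a (off a v) = σ b (off b v) := by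
  rcases eq_or_ne a b with rfl | hne
  · rfl
  have key : ∀ a b, a ≠ b → z a = z b → σ a (off a v) = v := by
    intro a b hne hab
    obtain ⟨⟨g, -, hg⟩, h2⟩ := hσ a (off a v) ⟨v, hv, rfl⟩
    obtain ⟨g', -, hg'⟩ := hv
    funext j
    by_cases hj : j = a
    · subst hj
      have h3 := congrFun h2 ⟨b, hne.symm⟩
      simp only [off] at h3
      have h4 : σ j (off j v) j = σ j (off j v) b := by
        rw [← hg]; simp [hab]
      rw [h4, h3, ← hg']
      simp [hab]
    · exact congrFun h2 ⟨j, hj⟩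
  rw [key a b hne hab, key b a hne.symm hab.symm]

section
variable {X Y : Type*} [Countable Y] [Nonempty Y]

/-- The canonical optimal orientation for the points in increasing order of their keys `φ`. -/
noncomputable def sortedOrientation (H : Set (X → Y)) (φ : X → ℝ) (n : ℕ) (x : Fin n → X) :
    EdgeMap Y n :=
  (optOrientation (restrict H (x ∘ Tuple.sort (φ ∘ x)))).reorder (Tuple.sort (φ ∘ x))

lemma isOptimalOrientation_sortedOrientation (H : Set (X → Y)) (φ : X → ℝ) (n : ℕ)
    (x : Fin n → X) : IsOptimalOrientation (restrict H x) (sortedOrientation H φ n x) :=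
  (isOptimalOrientation_optOrientation _).reorder fun w => (comp_perm_mem_restrict _ x w).symm

lemma outdeg_sortedOrientation_le {H : Set (X → Y)} {d : ℕ} (hd : HasDSDim H d) (φ : X → ℝ)
    {n : ℕ} {x : Fin n → X} {w : Fin n → Y} (hw : w ∈ restrict H x) :
    outdeg (sortedOrientation H φ n x) w ≤ d := by
  rw [sortedOrientation, outdeg_reorder]
  exact (hd.pseudoCubeFree _).outdeg_optOrientation_le ((comp_perm_mem_restrict _ x w).2 hw)

/-- Injective keys make both sorted sequences equal. The sorting permutations may still differ at
repeated points, but edges in the directions of a repeated point are singletons, so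
`orientation_eq_of_point_eq` removes the ambiguity. -/
lemma sortedOrientation_comp {H : Set (X → Y)} {φ : X → ℝ} (hφ : Function.Injective φ) {n : ℕ}
    (x : Fin n → X) (π : Equiv.Perm (Fin n)) {w : Fin n → Y} (hw : w ∈ restrict H x) (i : Fin n) :
    sortedOrientation H φ n (x ∘ π) i (off i (w ∘ π)) =
      sortedOrientation H φ n x (π i) (off (π i) w) ∘ π := by
  have hz : (x ∘ π) ∘ Tuple.sort (φ ∘ x ∘ π) = x ∘ Tuple.sort (φ ∘ x) := by
    have := Tuple.comp_perm_comp_sort_eq_comp_sort (f := φ ∘ x) (σ := π)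
    exact hφ.comp_left this
  simp only [sortedOrientation, EdgeMap.reorder_off]
  rw [hz]
  set s := Tuple.sort (φ ∘ x)
  set s' := Tuple.sort (φ ∘ x ∘ π)
  set z := x ∘ s
  obtain ⟨h, hh, rfl⟩ := hw
  have hv : h ∘ z ∈ restrict H z := ⟨h, hh, rfl⟩
  have e1 : ((h ∘ x) ∘ π) ∘ s' = h ∘ z := by rw [← hz]; rfl
  have e2 : (h ∘ x) ∘ s = h ∘ z := rfl
  have hab : z (s'.symm i) = z (s.symm (π i)) := by
    have : z (s'.symm i) = x (π i) := by rw [← hz]; simp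
    rw [this]; simp [z]
  simp only at *
  rw [e1, e2, orientation_eq_of_point_eq (isOrientation_optOrientation _) hab hv]
  obtain ⟨⟨g, -, hg⟩, -⟩ := isOrientation_optOrientation (restrict H z) (s.symm (π i))
    (off _ (h ∘ z)) ⟨_, hv, rfl⟩
  rw [← hg]
  have h1 : z ∘ s'.symm = x ∘ π := by rw [← hz, comp_perm_comp_symm]
  have h2 : z ∘ s.symm = x := comp_perm_comp_symm _ _
  calc (g ∘ z) ∘ s'.symm = g ∘ (z ∘ s'.symm) := rfl
    _ = g ∘ ((z ∘ s.symm) ∘ π) := by rw [h1, h2]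
    _ = _ := rfl

/-! ### The predictor -/

/-- The one-inclusion graph predictor of the canonical orientations. -/
noncomputable def oigPredictor (H : Set (X → Y)) (φ : X → ℝ) : Learner X Y := fun n S x =>
  sortedOrientation H φ (n + 1) (Fin.snoc (α := fun _ => X) (fun i => (S i).1) x) (Fin.last n)
    (off (Fin.last n) (Fin.snoc (α := fun _ => Y) (fun i => (S i).2) (Classical.arbitrary Y)))
    (Fin.last n)

lemma isOIGPredictor_oigPredictor (H : Set (X → Y)) {φ : X → ℝ} (hφ : Function.Injective φ) :
    IsOIGPredictor H (oigPredictor H φ) := by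
  refine ⟨sortedOrientation H φ, fun n x => isOptimalOrientation_sortedOrientation H φ n x,
    fun n x π w hw i => sortedOrientation_comp hφ x π hw i, fun n S x f hf _ => ?_⟩
  -- The default label sits in the last coordinate, which `off` forgets.
  have : off (Fin.last n) (Fin.snoc (α := fun _ => Y) (fun i => (S i).2)
      (Classical.arbitrary Y)) = f := by
    funext ⟨j, hj⟩
    induction j using Fin.lastCases with
    | last => exact absurd rfl hj
    | cast j => simp [off, hf j hj]
  rw [oigPredictor, this]

/-- The samples of size `t + 1` on whose last element the predictor errs. -/
def errorSet (P : Learner X Y) (t : ℕ) : Set (Fin (t + 1) → X × Y) :=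
  {S | P t (Fin.init S) (S (Fin.last t)).1 ≠ (S (Fin.last t)).2}

lemma oigPredictor_init (H : Set (X → Y)) (φ : X → ℝ) {t : ℕ} (S : Fin (t + 1) → X × Y) :
    oigPredictor H φ t (Fin.init S) (S (Fin.last t)).1 =
      sortedOrientation H φ (t + 1) (fun i => (S i).1) (Fin.last t)
        (off (Fin.last t) fun i => (S i).2) (Fin.last t) := by
  have h1 : (Fin.snoc (α := fun _ => X) (fun i => (Fin.init S i).1) (S (Fin.last t)).1) =
      fun i => (S i).1 := Fin.snoc_init_self (α := fun _ => X) fun i => (S i).1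
  have h2 : off (Fin.last t) (Fin.snoc (α := fun _ => Y) (fun i => (Fin.init S i).2)
      (Classical.arbitrary Y)) = off (Fin.last t) fun i => (S i).2 := by
    funext ⟨j, hj⟩
    induction j using Fin.lastCases with
    | last => exact absurd rfl hj
    | cast j => simp [off, Fin.init]
  rw [oigPredictor, h1, h2]

lemma mem_errorSet_iff {H : Set (X → Y)} {φ : X → ℝ} {t : ℕ} {S : Fin (t + 1) → X × Y}
    (hS : (fun i => (S i).2) ∈ restrict H fun i => (S i).1) :
    S ∈ errorSet (oigPredictor H φ) t ↔
      sortedOrientation H φ (t + 1) (fun i => (S i).1) (Fin.last t)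
        (off (Fin.last t) fun i => (S i).2) ≠ fun i => (S i).2 := by
  rw [errorSet, Set.mem_ofPred_eq, oigPredictor_init, not_iff_not]
  refine ⟨fun h => funext fun j => ?_, fun h => by rw [h]⟩
  obtain ⟨-, h2⟩ := (isOptimalOrientation_sortedOrientation H φ (t + 1) fun i => (S i).1).1
    (Fin.last t) (off (Fin.last t) fun i => (S i).2) ⟨_, hS, rfl⟩
  by_cases hj : j = Fin.last t
  · rw [hj, h]
  · exact congrFun h2 ⟨j, hj⟩

/-- The leave-one-out bound for realizable samples. -/
lemma exists_leaveOneOut {H : Set (X → Y)} {d : ℕ} (hd : HasDSDim H d) {φ : X → ℝ}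
    (hφ : Function.Injective φ) {t : ℕ} {S : Fin (t + 1) → X × Y}
    (hS : (fun i => (S i).2) ∈ restrict H fun i => (S i).1) :
    ∃ E : Finset (Fin (t + 1)), E.card ≤ d ∧ ∀ π : Equiv.Perm (Fin (t + 1)),
      (S ∘ π ∈ errorSet (oigPredictor H φ) t ↔ π (Fin.last t) ∈ E) := by
  classical
  -- `E` collects the positions at which the vertex of true labels loses its edge. Its size is an
  -- out-degree, and by equivariance only the position held out matters.
  refine ⟨Finset.univ.filter fun i => sortedOrientation H φ (t + 1) (fun i => (S i).1) i
    (off i fun i => (S i).2) ≠ fun i => (S i).2, ?_, fun π => ?_⟩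
  · rw [← Set.ncard_coe_finset]
    simpa [outdeg] using outdeg_sortedOrientation_le hd φ hS
  · have hπ := (comp_perm_mem_restrict π (fun i => (S i).1) fun i => (S i).2).2 hS
    rw [mem_errorSet_iff (S := S ∘ π) hπ, Finset.mem_filter]
    simp only [Finset.mem_univ, true_and, not_iff_not, ne_eq]
    have := sortedOrientation_comp hφ (fun i => (S i).1) π hS (Fin.last t)
    change sortedOrientation H φ (t + 1) ((fun i => (S i).1) ∘ π) (Fin.last t)
      (off (Fin.last t) ((fun i => (S i).2) ∘ π)) = (fun i => (S i).2) ∘ π ↔ _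
    rw [this]
    exact π.surjective.injective_comp_right.eq_iff

/-! ### Measurability and realizability of random samples -/

variable [MeasurableSpace X] [MeasurableSpace Y] [DiscreteMeasurableSpace Y]

omit [Countable Y] [Nonempty Y] [MeasurableSpace Y] [DiscreteMeasurableSpace Y] in
lemma measurableSet_sort_eq {φ : X → ℝ} (hφ : Measurable φ) {n : ℕ} (s : Equiv.Perm (Fin n)) :
    MeasurableSet {x : Fin n → X | Tuple.sort (φ ∘ x) = s} := by
  have hc : ∀ i, Measurable fun x : Fin n → X => φ (x i) := fun i => hφ.comp (measurable_pi_apply i)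
  have h1 : MeasurableSet {x : Fin n → X | ∀ a b, a ≤ b → φ (x (s a)) ≤ φ (x (s b))} :=
    measurableSet_setOf_forall fun a => measurableSet_setOf_forall fun b =>
      (MeasurableSet.const _).imp (measurableSet_le (hc _) (hc _))
  have h2 : MeasurableSet {x : Fin n → X | ∀ a b, a < b → φ (x (s a)) = φ (x (s b)) → s a < s b} :=
    measurableSet_setOf_forall fun a => measurableSet_setOf_forall fun b =>
      (MeasurableSet.const _).imp ((measurableSet_eq_fun (hc _) (hc _)).imp (MeasurableSet.const _))
  simp only [eq_comm (b := s), Tuple.eq_sort_iff]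
  exact h1.inter h2

omit [MeasurableSpace Y] [DiscreteMeasurableSpace Y] in
lemma nullMeasurableSet_sortedOrientation_eq {H : Set (X → Y)} (hH : MeasurablePatterns H)
    {φ : X → ℝ} (hφ : Measurable φ) {n : ℕ} (i : Fin n) (f : {j : Fin n // j ≠ i} → Y)
    (v : Fin n → Y) (μ : Measure X) [IsProbabilityMeasure μ] :
    NullMeasurableSet {x | sortedOrientation H φ n x i f = v} (Measure.pi fun _ : Fin n => μ) := by
  have : {x | sortedOrientation H φ n x i f = v} = ⋃ s : Equiv.Perm (Fin n),
      {x | Tuple.sort (φ ∘ x) = s} ∩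
        {x | (optOrientation (restrict H (x ∘ s))).reorder s i f = v} := by
    ext x
    simp [sortedOrientation]
  rw [this]
  refine NullMeasurableSet.iUnion fun s => (measurableSet_sort_eq hφ s).nullMeasurableSet.inter ?_
  have hv : {x | (optOrientation (restrict H (x ∘ s))).reorder s i f = v} =
      {x | optOrientation (restrict H (x ∘ s)) (s.symm i)
        (fun j => f ⟨s j, fun h => j.2 (s.eq_symm_apply.2 h)⟩) = v ∘ s} := by
    ext x
    simp only [Set.mem_ofPred_eq, EdgeMap.reorder]
    constructor
    · rintro rfl
      rw [comp_symm_comp_perm]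
    · intro h
      rw [h, comp_perm_comp_symm]
  rw [hv]
  -- On the completed σ-algebra the pattern events are measurable, so the measurable choice applies
  -- verbatim.
  refine measurableSet_optOrientation_eq (W := fun x => restrict H (x ∘ s))
    (Ω := NullMeasurableSpace (Fin n → X) (Measure.pi fun _ : Fin n => μ)) (fun u => ?_) _ _ _
  have := hH n (u ∘ s.symm) μ inferInstance
  have heq : {x | u ∘ s.symm ∈ restrict H x} = {x | u ∈ restrict H (x ∘ s)} := by
    ext x
    rw [Set.mem_ofPred_eq, Set.mem_ofPred_eq, ← comp_perm_mem_restrict s, comp_symm_comp_perm]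
  rwa [heq] at this

/-- Label vectors and vertices are countably many. Once both are fixed, the remaining event concerns
the points alone and is pulled back from the marginal on `X`. -/
lemma nullMeasurableSet_errorSet {H : Set (X → Y)} (hH : MeasurablePatterns H) {φ : X → ℝ}
    (hφ : Measurable φ) (t : ℕ) (D : Measure (X × Y)) [IsProbabilityMeasure D] :
    NullMeasurableSet (errorSet (oigPredictor H φ) t) (Measure.pi fun _ : Fin (t + 1) => D) := by
  have : IsProbabilityMeasure (D.map Prod.fst) :=
    Measure.isProbabilityMeasure_map measurable_fst.aemeasurable
  have hmp : MeasurePreserving (fun (S : Fin (t + 1) → X × Y) i => (S i).1)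
      (Measure.pi fun _ : Fin (t + 1) => D) (Measure.pi fun _ : Fin (t + 1) => D.map Prod.fst) :=
    ⟨by fun_prop, Measure.pi_map_pi fun _ => measurable_fst.aemeasurable⟩
  have heq : errorSet (oigPredictor H φ) t = ⋃ (y : Fin (t + 1) → Y) (v : Fin (t + 1) → Y),
      {S | (fun i => (S i).2) = y} ∩ ((fun (S : Fin (t + 1) → X × Y) i => (S i).1) ⁻¹'
        {x | sortedOrientation H φ (t + 1) x (Fin.last t) (off (Fin.last t) y) = v} ∩
        {_S | v (Fin.last t) ≠ y (Fin.last t)}) := by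
    ext S
    simp only [errorSet, Set.mem_ofPred_eq, oigPredictor_init, Set.mem_iUnion, Set.mem_inter_iff,
      Set.mem_preimage]
    constructor
    · intro h
      exact ⟨_, _, rfl, rfl, h⟩
    · rintro ⟨_, _, rfl, rfl, h⟩
      exact h
  rw [heq]
  refine NullMeasurableSet.iUnion fun y => NullMeasurableSet.iUnion fun v =>
    NullMeasurableSet.inter ?_ (NullMeasurableSet.inter ?_ (MeasurableSet.const _).nullMeasurableSet)
  · have hm : Measurable fun (S : Fin (t + 1) → X × Y) i => (S i).2 := by fun_prop
    exact (hm (measurableSet_singleton y)).nullMeasurableSet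
  · exact (nullMeasurableSet_sortedOrientation_eq hH hφ _ _ _ _).preimage hmp.quasiMeasurePreserving

omit [Countable Y] [Nonempty Y] [DiscreteMeasurableSpace Y] in
/-- Almost every sample from a realizable distribution is realized by a member of the class. -/
lemma Realizable.ae_mem_restrict {H : Set (X → Y)} {D : Measure (X × Y)} [IsProbabilityMeasure D]
    (hD : Realizable H D) (n : ℕ) : ∀ᵐ S ∂(Measure.pi fun _ : Fin n => D),
      (fun i => (S i).2) ∈ restrict H fun i => (S i).1 := by
  rw [ae_iff]
  set a := (Measure.pi fun _ : Fin n => D)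
    {S | ¬ (fun i => (S i).2) ∈ restrict H fun i => (S i).1} with ha
  have hle : ∀ h ∈ H, a ≤ n * err D h := by
    intro h hh
    set A := toMeasurable D {p : X × Y | h p.1 ≠ p.2} with hA
    calc a ≤ (Measure.pi fun _ : Fin n => D) (⋃ i : Fin n, (fun S => S i) ⁻¹' A) := by
          refine measure_mono fun S hS => ?_
          by_contra hc
          refine hS ⟨h, hh, funext fun i => ?_⟩
          by_contra hne
          exact hc (Set.mem_iUnion.2 ⟨i, subset_toMeasurable _ _ hne⟩)
      _ ≤ ∑ i : Fin n, (Measure.pi fun _ : Fin n => D) ((fun S => S i) ⁻¹' A) :=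
          measure_iUnion_fintype_le _ _
      _ = ∑ _i : Fin n, D A := Finset.sum_congr rfl fun i _ =>
          (measurePreserving_eval (fun _ : Fin n => D) i).measure_preimage
            (measurableSet_toMeasurable _ _).nullMeasurableSet
      _ = n * err D h := by simp [hA, measure_toMeasurable, err]
  by_contra hne
  -- The infimum need not be attained, hence the comparison of `err D h` with `a / n`. For `n = 0`
  -- the bound `hle` already gives `a = 0`, as `H` is nonempty: an infimum over no hypotheses would
  -- be `⊤`.
  have hn : (n : ℝ≥0∞) ≠ 0 := by
    intro h0
    rw [Realizable] at hD
    obtain ⟨h, hh, -⟩ : ∃ h ∈ H, err D h < ⊤ := by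
      have : (⨅ h ∈ H, err D h) < ⊤ := by rw [hD]; exact ENNReal.zero_lt_top
      simpa only [iInf_lt_iff, exists_prop] using this
    exact hne (le_antisymm (by simpa [h0] using hle h hh) zero_le)
  have hlt : (⨅ h ∈ H, err D h) < a / n := by
    rw [hD]
    exact ENNReal.div_pos hne (ENNReal.natCast_ne_top n)
  simp only [iInf_lt_iff, exists_prop] at hlt
  obtain ⟨h, hh, hlt⟩ := hlt
  have := ENNReal.mul_lt_of_lt_div' hlt
  exact absurd (hle h hh) (not_le.2 this)
end

/-! ### Samples of independent random points -/

section
variable {Z : Type*} [MeasurableSpace Z] (D : Measure Z) [IsProbabilityMeasure D]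

/-- Selecting distinct elements of an independent sample yields an independent sample. -/
lemma measurePreserving_comp_injective {ι ι' : Type*} [Fintype ι] [Fintype ι'] {e : ι' → ι}
    (he : Function.Injective e) :
    MeasurePreserving (fun (S : ι → Z) i => S (e i)) (Measure.pi fun _ => D)
      (Measure.pi fun _ => D) := by
  refine ⟨by fun_prop, ?_⟩
  have hind : ProbabilityTheory.iIndepFun (fun i (S : ι → Z) => S i) (Measure.pi fun _ => D) :=
    ProbabilityTheory.iIndepFun_pi (X := fun _ => id) fun _ => aemeasurable_id
  have h := (ProbabilityTheory.iIndepFun_iff_map_fun_eq_pi_map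
    (fun i => (measurable_pi_apply (e i)).aemeasurable)).1 (hind.precomp he)
  rw [h]
  congr 1
  funext i
  exact (measurePreserving_eval (fun _ : ι => D) (e i)).map_eq

lemma measurePreserving_snoc (m : ℕ) :
    MeasurePreserving (fun p : (Fin m → Z) × Z => (Fin.snoc (α := fun _ => Z) p.1 p.2))
      ((Measure.pi fun _ => D).prod D) (Measure.pi fun _ : Fin (m + 1) => D) := by
  have h := (measurePreserving_piFinSuccAbove (fun _ : Fin (m + 1) => D) (Fin.last m)).symm
  have h2 := h.comp (Measure.measurePreserving_swap (μ := Measure.pi fun _ : Fin m => D) (ν := D))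
  convert h2 using 1
  funext p
  simp [MeasurableEquiv.piFinSuccAbove, Fin.insertNthEquiv]

variable {D} in
lemma lintegral_pi_snoc {m : ℕ} {F : (Fin (m + 1) → Z) → ℝ≥0∞}
    (hF : AEMeasurable F (Measure.pi fun _ => D)) :
    ∫⁻ S, F S ∂(Measure.pi fun _ => D) =
      ∫⁻ S, ∫⁻ z, F (Fin.snoc (α := fun _ => Z) S z) ∂D ∂(Measure.pi fun _ : Fin m => D) := by
  have hmp := measurePreserving_snoc D m
  rw [← hmp.map_eq] at hF ⊢
  rw [lintegral_map' hF hmp.aemeasurable,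
    lintegral_prod (fun p : (Fin m → Z) × Z => F (Fin.snoc (α := fun _ => Z) p.1 p.2))
      (hF.comp_aemeasurable hmp.aemeasurable)]

/-- The first `k` elements of a sample. -/
def samplePrefix {m k : ℕ} (h : k ≤ m) (S : Fin m → Z) : Fin k → Z := fun i => S (Fin.castLE h i)

lemma measurePreserving_samplePrefix {m k : ℕ} (h : k ≤ m) :
    MeasurePreserving (samplePrefix (Z := Z) h) (Measure.pi fun _ => D) (Measure.pi fun _ => D) :=
  measurePreserving_comp_injective D (Fin.castLE_injective h)

variable {D}

/-- A product of factors with conditional mean at most one has mean at most one. -/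
lemma lintegral_prod_prefix_le_one {e : ∀ t : ℕ, (Fin (t + 1) → Z) → ℝ≥0∞}
    (hm : ∀ t, AEMeasurable (e t) (Measure.pi fun _ => D)) (hfin : ∀ t S, e t S ≠ ⊤)
    (h1 : ∀ t, ∀ᵐ S ∂(Measure.pi fun _ : Fin t => D),
      ∫⁻ z, e t (Fin.snoc (α := fun _ => Z) S z) ∂D ≤ 1) (m : ℕ) :
    ∫⁻ S, ∏ t : Fin m, e t (samplePrefix t.isLt S) ∂(Measure.pi fun _ => D) ≤ 1 := by
  induction m with
  | zero => simp
  | succ m ih =>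
    have hmeas : AEMeasurable (fun S : Fin (m + 1) → Z => ∏ t : Fin (m + 1),
        e t (samplePrefix t.isLt S)) (Measure.pi fun _ => D) :=
      Finset.aemeasurable_fun_prod _ fun t _ => (hm t).comp_quasiMeasurePreserving
        (measurePreserving_samplePrefix D t.isLt).quasiMeasurePreserving
    rw [lintegral_pi_snoc hmeas]
    refine le_trans (lintegral_mono_ae ?_) ih
    filter_upwards [h1 m] with S hS
    have hsplit : ∀ z, ∏ t : Fin (m + 1),
        e t (samplePrefix t.isLt (Fin.snoc (α := fun _ => Z) S z)) =
        (∏ t : Fin m, e t (samplePrefix t.isLt S)) * e m (Fin.snoc (α := fun _ => Z) S z) := by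
      intro z
      rw [Fin.prod_univ_castSucc]
      congr 1
      refine Finset.prod_congr rfl fun t _ => congrArg _ (funext fun i => ?_)
      have : Fin.castLE (t.castSucc.isLt : (t : ℕ) + 1 ≤ m + 1) i =
          (Fin.castLE (t.isLt : (t : ℕ) + 1 ≤ m) i).castSucc := rfl
      simp only [samplePrefix]
      erw [this, Fin.snoc_castSucc]
    simp only [hsplit]
    rw [lintegral_const_mul' _ _ (ENNReal.prod_ne_top fun t _ => hfin _ _)]
    exact mul_le_of_le_one_right' hS

/-- The probability that the next point lies in `B t`. -/
noncomputable def nextProb (D : Measure Z) (B : ∀ t : ℕ, Set (Fin (t + 1) → Z)) (t : ℕ)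
    (S : Fin t → Z) : ℝ≥0∞ :=
  ∫⁻ z, (B t).indicator 1 (Fin.snoc (α := fun _ => Z) S z) ∂D

variable {B : ∀ t : ℕ, Set (Fin (t + 1) → Z)}

lemma aemeasurable_indicator_snoc {t : ℕ} (hB : NullMeasurableSet (B t) (Measure.pi fun _ => D)) :
    AEMeasurable (fun p : (Fin t → Z) × Z => (B t).indicator (1 : (Fin (t + 1) → Z) → ℝ≥0∞)
      (Fin.snoc (α := fun _ => Z) p.1 p.2)) ((Measure.pi fun _ => D).prod D) :=
  ((aemeasurable_const (b := (1 : ℝ≥0∞))).indicator₀ hB).comp_quasiMeasurePreserving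
    (measurePreserving_snoc D t).quasiMeasurePreserving

lemma aemeasurable_nextProb {t : ℕ} (hB : NullMeasurableSet (B t) (Measure.pi fun _ => D)) :
    AEMeasurable (nextProb D B t) (Measure.pi fun _ => D) :=
  (aemeasurable_indicator_snoc hB).lintegral_prod_right'

lemma ae_aemeasurable_indicator_snoc {t : ℕ}
    (hB : NullMeasurableSet (B t) (Measure.pi fun _ => D)) :
    ∀ᵐ S ∂(Measure.pi fun _ : Fin t => D), AEMeasurable (fun z => (B t).indicator
      (1 : (Fin (t + 1) → Z) → ℝ≥0∞) (Fin.snoc (α := fun _ => Z) S z)) D :=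
  (aemeasurable_indicator_snoc hB).aestronglyMeasurable.prodMk_left.mono fun _ h => h.aemeasurable

lemma nextProb_le_one (t : ℕ) (S : Fin t → Z) : nextProb D B t S ≤ 1 := by
  calc nextProb D B t S ≤ ∫⁻ _z, 1 ∂D := lintegral_mono fun z => Set.indicator_le_self' (by simp) _
    _ = 1 := by simp

lemma indicator_eq_zero_or_one {α : Type*} (s : Set α) (x : α) :
    (s.indicator (1 : α → ℝ≥0∞) x = 0 ∧ s.indicator (1 : α → ℝ) x = 0) ∨
      (s.indicator (1 : α → ℝ≥0∞) x = 1 ∧ s.indicator (1 : α → ℝ) x = 1) := by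
  by_cases h : x ∈ s <;> simp [h]

/-- Given the past, `exp (-l x_t)` has mean `1 - κ q_t ≤ exp (-κ q_t)` with `κ = 1 - exp (-l)`, so
each factor has conditional mean at most one. Times before `a` contribute the factor `1`. -/
lemma lintegral_exp_martingale_le_one {l : ℝ} (hl : 0 ≤ l) (a : ℕ)
    (hB : ∀ t, NullMeasurableSet (B t) (Measure.pi fun _ => D)) (m : ℕ) :
    ∫⁻ S, ENNReal.ofReal (Real.exp (∑ t : Fin m with a ≤ Fin.val t,
      ((1 - Real.exp (-l)) * (nextProb D B t (samplePrefix t.isLt.le S)).toReal -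
        l * (B t).indicator 1 (samplePrefix t.isLt S)))) ∂(Measure.pi fun _ => D) ≤ 1 := by
  set κ := 1 - Real.exp (-l) with hκ
  have hκ0 : 0 ≤ κ := by
    have : Real.exp (-l) ≤ 1 := Real.exp_le_one_iff.2 (by linarith)
    linarith
  let e : ∀ t : ℕ, (Fin (t + 1) → Z) → ℝ≥0∞ := fun t S => if a ≤ t then ENNReal.ofReal
    (Real.exp (κ * (nextProb D B t (Fin.init S)).toReal - l * (B t).indicator 1 S)) else 1
  have hm : ∀ t, AEMeasurable (e t) (Measure.pi fun _ => D) := by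
    intro t
    by_cases hat : a ≤ t
    · simp only [e, if_pos hat]
      have hinit : MeasurePreserving (fun S : Fin (t + 1) → Z => (Fin.init S : Fin t → Z))
          (Measure.pi fun _ => D) (Measure.pi fun _ => D) :=
        measurePreserving_comp_injective D (Fin.castSucc_injective t)
      have h1 := ((aemeasurable_nextProb (hB t)).comp_quasiMeasurePreserving
        hinit.quasiMeasurePreserving).ennreal_toReal
      have h2 := (aemeasurable_const (b := (1 : ℝ)) (μ := Measure.pi fun _ : Fin (t + 1) => D)).indicator₀
        (hB t)
      exact (Real.measurable_exp.comp_aemeasurable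
        ((h1.const_mul κ).sub (h2.const_mul l))).ennreal_ofReal
    · simp only [e, if_neg hat]
      exact aemeasurable_const
  have hfin : ∀ t S, e t S ≠ ⊤ := by
    intro t S
    by_cases hat : a ≤ t <;> simp [e, hat]
  have h1 : ∀ t, ∀ᵐ S ∂(Measure.pi fun _ : Fin t => D),
      ∫⁻ z, e t (Fin.snoc (α := fun _ => Z) S z) ∂D ≤ 1 := by
    intro t
    by_cases hat : a ≤ t
    · filter_upwards [ae_aemeasurable_indicator_snoc (hB t)] with S hS
      set q := (nextProb D B t S).toReal with hq
      have hq1 : nextProb D B t S = ENNReal.ofReal q :=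
        (ENNReal.ofReal_toReal ((nextProb_le_one t S).trans_lt ENNReal.one_lt_top).ne).symm
      let A : Z → ℝ≥0∞ := fun z => ENNReal.ofReal
        (Real.exp (-(l * (B t).indicator 1 (Fin.snoc (α := fun _ => Z) S z))))
      have he : ∀ z, e t (Fin.snoc (α := fun _ => Z) S z) =
          ENNReal.ofReal (Real.exp (κ * q)) * A z := by
        intro z
        simp only [e, if_pos hat, A, Fin.init_snoc]
        rw [sub_eq_add_neg, Real.exp_add, ENNReal.ofReal_mul (Real.exp_nonneg _)]
      -- `exp (-l x)` is affine in `x` on `{0, 1}`, so its mean is computed exactly.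
      have hadd : ∀ z, A z + ENNReal.ofReal κ * (B t).indicator 1
          (Fin.snoc (α := fun _ => Z) S z) = 1 := by
        intro z
        simp only [A]
        rcases indicator_eq_zero_or_one (B t) (Fin.snoc (α := fun _ => Z) S z) with ⟨h, h'⟩ | ⟨h, h'⟩
        · rw [h, h']; simp
        · rw [h, h', mul_one, mul_one, ← ENNReal.ofReal_add (Real.exp_nonneg _) hκ0, hκ]
          simp
      have hint : ∫⁻ z, A z ∂D + ENNReal.ofReal (κ * q) = 1 := by
        rw [ENNReal.ofReal_mul hκ0, ← hq1, nextProb, ← lintegral_const_mul'' _ hS,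
          ← lintegral_add_right' _ (hS.const_mul _)]
        simp [hadd]
      have hA : ∫⁻ z, A z ∂D ≤ ENNReal.ofReal (Real.exp (-(κ * q))) := by
        rw [ENNReal.eq_sub_of_add_eq ENNReal.ofReal_ne_top hint, ← ENNReal.ofReal_one,
          ← ENNReal.ofReal_sub _ (by positivity)]
        refine ENNReal.ofReal_le_ofReal ?_
        have := Real.add_one_le_exp (-(κ * q))
        linarith
      simp only [he]
      rw [lintegral_const_mul' _ _ ENNReal.ofReal_ne_top]
      calc _ ≤ ENNReal.ofReal (Real.exp (κ * q)) * ENNReal.ofReal (Real.exp (-(κ * q))) := by gcongr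
        _ = 1 := by rw [← ENNReal.ofReal_mul (Real.exp_nonneg _), ← Real.exp_add]; simp
    · simp [e, hat]
  refine le_trans (le_of_eq (lintegral_congr fun S => ?_)) (lintegral_prod_prefix_le_one hm hfin h1 m)
  rw [Real.exp_sum, ENNReal.ofReal_prod_of_nonneg fun _ _ => Real.exp_nonneg _, Finset.prod_filter]
  exact Finset.prod_congr rfl fun t _ => rfl

/-! ### The reversed process -/

/-- The `B t` behave like the errors of a permutation invariant predictor that makes at most `d`
leave-one-out errors on every sample. -/
def LeaveOneOutBound (D : Measure Z) (B : ∀ t : ℕ, Set (Fin (t + 1) → Z)) (d : ℕ) : Prop :=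
  ∀ t, ∀ᵐ S ∂(Measure.pi fun _ : Fin (t + 1) => D), ∃ E : Finset (Fin (t + 1)), E.card ≤ d ∧
    ∀ π : Equiv.Perm (Fin (t + 1)), (S ∘ π ∈ B t ↔ π (Fin.last t) ∈ E)

omit [MeasurableSpace Z] in
lemma samplePrefix_comp_swap {m k : ℕ} (h : k ≤ m) (S : Fin m → Z) (i j : Fin k) :
    samplePrefix h (S ∘ Equiv.swap (Fin.castLE h i) (Fin.castLE h j)) =
      samplePrefix h S ∘ Equiv.swap i j := by
  funext l
  simp only [samplePrefix, Function.comp_apply]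
  rw [(Fin.castLE_injective h).map_swap]

/-- One factor of the telescoping product, from `1 / (a + 1) ≤ log (a + 1) - log a` and `1 + y ≤ exp
y`. -/
lemma one_add_div_le_exp {x : ℝ} (hx : 0 ≤ x) {a : ℕ} (ha : 1 ≤ a) :
    (a + 1 : ℝ) + x ≤ (a + 1) * Real.exp (x * (Real.log (a + 1) - Real.log a)) := by
  have ha' : (0 : ℝ) < a := by exact_mod_cast ha
  have h1 : 1 / (a + 1 : ℝ) ≤ Real.log (a + 1) - Real.log a := by
    rw [← Real.log_div (by positivity) (by positivity)]
    refine le_trans (le_of_eq ?_) (Real.one_sub_inv_le_log_of_pos (by positivity))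
    field_simp
    ring
  have h2 := Real.add_one_le_exp (x * (Real.log (a + 1) - Real.log a))
  have h3 : x * (1 / (a + 1 : ℝ)) ≤ x * (Real.log (a + 1) - Real.log a) := by gcongr
  calc (a + 1 : ℝ) + x = (a + 1) * (x * (1 / (a + 1 : ℝ)) + 1) := by field_simp; ring
    _ ≤ _ := by gcongr; linarith

/-- Backwards induction on `a`. The later factors are invariant under permutations of the first `a +
1` examples, and averaging over which of these comes last gives the factor at time `a` the mean at
most `1 + c d / (a + 1)`. -/
lemma lintegral_prod_reversed_le {d : ℕ}
    (hB : ∀ t, NullMeasurableSet (B t) (Measure.pi fun _ => D)) (hloo : LeaveOneOutBound D B d)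
    {c : ℝ} (hc : 0 ≤ c) {m a : ℕ} (ha : 1 ≤ a) (ham : a ≤ m) :
    ∫⁻ S : Fin m → Z, ∏ t : Fin m with a ≤ Fin.val t, (1 + ENNReal.ofReal c *
      (B t).indicator 1 (samplePrefix t.isLt S)) ∂(Measure.pi fun _ => D) ≤
      ENNReal.ofReal (Real.exp (c * d * (Real.log m - Real.log a))) := by
  induction ham using Nat.decreasingInduction with
  | self => simp [fun t : Fin m => not_le.2 t.isLt]
  | of_succ a ham ih =>
    have ih := ih (by omega)
    let X : Fin m → (Fin m → Z) → ℝ≥0∞ := fun t S =>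
      1 + ENNReal.ofReal c * (B t).indicator 1 (samplePrefix t.isLt S)
    let R : (Fin m → Z) → ℝ≥0∞ := fun S => ∏ t : Fin m with a + 1 ≤ Fin.val t, X t S
    let a' : Fin m := ⟨a, ham⟩
    have hXm : ∀ t, AEMeasurable (X t) (Measure.pi fun _ => D) := fun t =>
      ((((aemeasurable_const (b := (1 : ℝ≥0∞))).indicator₀ (hB t)).comp_quasiMeasurePreserving
        (measurePreserving_samplePrefix D t.isLt).quasiMeasurePreserving).const_mul _).const_add _
    have hRm : AEMeasurable R (Measure.pi fun _ => D) :=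
      Finset.aemeasurable_fun_prod _ fun t _ => hXm t
    have hsplit : ∀ S, ∏ t : Fin m with a ≤ Fin.val t, (1 + ENNReal.ofReal c *
        (B t).indicator 1 (samplePrefix t.isLt S)) = X a' S * R S := by
      intro S
      have : (Finset.univ.filter fun t : Fin m => a ≤ t) =
          insert a' (Finset.univ.filter fun t : Fin m => a + 1 ≤ t) := by
        ext t
        simp only [Finset.mem_filter, Finset.mem_univ, true_and, Finset.mem_insert, Fin.ext_iff, a']
        omega
      rw [this, Finset.prod_insert (by simp [a'])]
    -- `τ j` moves the example `j` to the held-out position `a`; it preserves the law of the sample.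
    let τ : Fin (a + 1) → Equiv.Perm (Fin m) := fun j =>
      Equiv.swap (Fin.castLE (show a + 1 ≤ m from ham) j) a'
    have hτ : ∀ j, MeasurePreserving (fun S : Fin m → Z => S ∘ τ j) (Measure.pi fun _ => D)
        (Measure.pi fun _ => D) := fun j =>
      measurePreserving_comp_injective D (τ j).injective
    have hI : ∀ j, ∫⁻ S, X a' (S ∘ τ j) * R (S ∘ τ j) ∂(Measure.pi fun _ => D) =
        ∫⁻ S, X a' S * R S ∂(Measure.pi fun _ => D) := by
      intro j
      have h := ((hXm a').mul hRm)
      rw [← (hτ j).map_eq] at h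
      conv_rhs => rw [← (hτ j).map_eq]
      exact (lintegral_map' h (hτ j).aemeasurable).symm
    have hall : ∀ᵐ S ∂(Measure.pi fun _ : Fin m => D), ∀ t : Fin m,
        ∃ E : Finset (Fin (t + 1)), E.card ≤ d ∧ ∀ π : Equiv.Perm (Fin (t + 1)),
          (samplePrefix t.isLt S ∘ π ∈ B t ↔ π (Fin.last t) ∈ E) :=
      ae_all_iff.2 fun t => (measurePreserving_samplePrefix D
        (show (t : ℕ) + 1 ≤ m from t.isLt)).quasiMeasurePreserving.ae (hloo t)
    have hsum : ∀ᵐ S ∂(Measure.pi fun _ : Fin m => D),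
        ∑ j, X a' (S ∘ τ j) * R (S ∘ τ j) ≤ ENNReal.ofReal (a + 1 + c * d) * R S := by
      filter_upwards [hall] with S hS
      -- For `t > a` the swap permutes the training part of the prefix of length `t + 1` and fixes
      -- its last element.
      have hR : ∀ j, R (S ∘ τ j) = R S := by
        intro j
        refine Finset.prod_congr rfl fun t ht => ?_
        have hat : a + 1 ≤ t := (Finset.mem_filter.1 ht).2
        obtain ⟨E, -, hE⟩ := hS t
        have hmt : (t : ℕ) + 1 ≤ m := t.isLt
        have hpre : samplePrefix hmt (S ∘ τ j) = samplePrefix hmt S ∘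
            Equiv.swap (Fin.castLE (by omega) j) (⟨a, by omega⟩ : Fin (t + 1)) :=
          samplePrefix_comp_swap hmt S (Fin.castLE (by omega) j) ⟨a, by omega⟩
        have hlast : Equiv.swap (Fin.castLE (by omega) j) (⟨a, by omega⟩ : Fin (t + 1))
            (Fin.last t) = Fin.last t := by
          refine Equiv.swap_apply_of_ne_of_ne ?_ ?_ <;>
            · rw [ne_eq, Fin.ext_iff]
              simp only [Fin.val_last, Fin.val_castLE]
              omega
        have hiff : samplePrefix hmt (S ∘ τ j) ∈ B t ↔ samplePrefix hmt S ∈ B t := by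
          rw [hpre, hE, hlast]
          exact (hE 1).symm
        simp only [X]
        congr 2
        by_cases hmem : samplePrefix hmt S ∈ B t
        · rw [Set.indicator_of_mem hmem, Set.indicator_of_mem (hiff.2 hmem)]; rfl
        · rw [Set.indicator_of_notMem hmem, Set.indicator_of_notMem (mt hiff.1 hmem)]
      obtain ⟨E, hEd, hE⟩ := hS a'
      -- After the swap an error occurs exactly for `j ∈ E`, that is, for at most `d` of the `a + 1`
      -- values of `j`.
      have hX : ∀ j : Fin (a + 1), X a' (S ∘ τ j) =
          1 + ENNReal.ofReal c * (E : Set (Fin (a + 1))).indicator 1 j := by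
        intro j
        have hpre : samplePrefix a'.isLt (S ∘ τ j) = samplePrefix a'.isLt S ∘
            Equiv.swap j (Fin.last a) := samplePrefix_comp_swap a'.isLt S j (Fin.last a)
        have hiff : samplePrefix a'.isLt (S ∘ τ j) ∈ B a' ↔ j ∈ E := by
          rw [hpre, hE]
          exact iff_of_eq (congrArg (· ∈ E) (Equiv.swap_apply_right j (Fin.last a)))
        simp only [X]
        congr 2
        by_cases hmem : j ∈ E
        · rw [Set.indicator_of_mem (hiff.2 hmem), Set.indicator_of_mem (Finset.mem_coe.2 hmem)]; rfl
        · rw [Set.indicator_of_notMem (mt hiff.1 hmem),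
            Set.indicator_of_notMem (mt Finset.mem_coe.1 hmem)]
      simp only [hR, hX, ← Finset.sum_mul]
      gcongr
      rw [Finset.sum_add_distrib, ← Finset.mul_sum]
      have hcard : ∑ j, (E : Set (Fin (a + 1))).indicator (1 : Fin (a + 1) → ℝ≥0∞) j = E.card := by
        simp [Set.indicator_apply]
      rw [hcard, ENNReal.ofReal_add (by positivity) (by positivity), ENNReal.ofReal_mul hc,
        ENNReal.ofReal_natCast]
      gcongr
      simp only [Finset.sum_const, Finset.card_univ, Fintype.card_fin, nsmul_eq_mul, mul_one]
      rw [← Nat.cast_add_one, ENNReal.ofReal_natCast]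
    have hkey : ((a + 1 : ℕ) : ℝ≥0∞) * ∫⁻ S, X a' S * R S ∂(Measure.pi fun _ => D) ≤
        ENNReal.ofReal (a + 1 + c * d) * ∫⁻ S, R S ∂(Measure.pi fun _ => D) := by
      rw [← lintegral_const_mul'' _ hRm]
      refine le_trans (le_of_eq ?_) (lintegral_mono_ae hsum)
      rw [lintegral_finsetSum' (f := fun j S => X a' (S ∘ τ j) * R (S ∘ τ j)) _ fun j _ =>
        ((hXm a').mul hRm).comp_quasiMeasurePreserving (hτ j).quasiMeasurePreserving]
      simp [hI]
    simp only [hsplit]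
    have hpos : ((a + 1 : ℕ) : ℝ≥0∞) ≠ 0 := by simp
    rw [← ENNReal.mul_le_mul_iff_right hpos (ENNReal.natCast_ne_top _)]
    refine hkey.trans ?_
    calc _ ≤ ENNReal.ofReal ((a + 1) * Real.exp (c * d * (Real.log (a + 1) - Real.log a))) *
          ENNReal.ofReal (Real.exp (c * d * (Real.log m - Real.log (a + 1 : ℕ)))) := by
          gcongr
          exact one_add_div_le_exp (by positivity) ha
      _ = _ := by
          rw [← ENNReal.ofReal_mul (by positivity), ← ENNReal.ofReal_natCast,
            ← ENNReal.ofReal_mul (by positivity), mul_assoc, ← Real.exp_add]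
          rw [Nat.cast_add_one, ← mul_add]
          congr 4
          ring

/-! ### The tail bound -/

/-- Markov's inequality for the forward and for the backward exponential costs `δ / 2` each. Outside
both events, `η ∑ x_t < K + L` and `(1 - exp (-l)) ∑ q_t < l ∑ x_t + L`, and eliminating `∑ x_t`
gives the threshold. -/
lemma measure_sum_nextProb_ge_le {d : ℕ}
    (hB : ∀ t, NullMeasurableSet (B t) (Measure.pi fun _ => D)) (hloo : LeaveOneOutBound D B d)
    {l η δ : ℝ} (hl : 0 ≤ l) (hη : 0 < η) (hδ : 0 < δ) {m a : ℕ} (ha : 1 ≤ a) (ham : a ≤ m) :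
    (Measure.pi fun _ : Fin m => D) {S |
      l / η * ((Real.exp η - 1) * d * (Real.log m - Real.log a) + Real.log (2 / δ)) +
        Real.log (2 / δ) ≤ (1 - Real.exp (-l)) *
          ∑ t : Fin m with a ≤ Fin.val t, (nextProb D B t (samplePrefix t.isLt.le S)).toReal} ≤
      ENNReal.ofReal δ := by
  set L := Real.log (2 / δ) with hL
  set K := (Real.exp η - 1) * d * (Real.log m - Real.log a) with hK
  have hc : 0 ≤ Real.exp η - 1 := by
    have := Real.one_le_exp hη.le
    linarith
  let F : (Fin m → Z) → ℝ≥0∞ := fun S => ENNReal.ofReal (Real.exp (∑ t : Fin m with a ≤ Fin.val t,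
      ((1 - Real.exp (-l)) * (nextProb D B t (samplePrefix t.isLt.le S)).toReal -
        l * (B t).indicator 1 (samplePrefix t.isLt S))))
  let G : (Fin m → Z) → ℝ≥0∞ := fun S => ∏ t : Fin m with a ≤ Fin.val t,
    (1 + ENNReal.ofReal (Real.exp η - 1) * (B t).indicator 1 (samplePrefix t.isLt S))
  have hG : ∀ S, G S = ENNReal.ofReal (Real.exp (η *
      ∑ t : Fin m with a ≤ Fin.val t, (B t).indicator 1 (samplePrefix t.isLt S))) := by
    intro S
    rw [Finset.mul_sum, Real.exp_sum, ENNReal.ofReal_prod_of_nonneg fun _ _ => Real.exp_nonneg _]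
    refine Finset.prod_congr rfl fun t _ => ?_
    rcases indicator_eq_zero_or_one (B t) (samplePrefix t.isLt S) with ⟨h, h'⟩ | ⟨h, h'⟩
    · rw [h, h']; simp
    · rw [h, h', mul_one, mul_one, ← ENNReal.ofReal_one, ← ENNReal.ofReal_add zero_le_one hc]
      congr 1
      ring
  have hxm : ∀ t : Fin m, AEMeasurable (fun S : Fin m → Z => (B t).indicator (1 : (Fin (t + 1) → Z) → ℝ)
      (samplePrefix t.isLt S)) (Measure.pi fun _ => D) := fun t =>
    ((aemeasurable_const (b := (1 : ℝ))).indicator₀ (hB t)).comp_quasiMeasurePreserving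
      (measurePreserving_samplePrefix D t.isLt).quasiMeasurePreserving
  have hFm : AEMeasurable F (Measure.pi fun _ => D) := by
    refine (Real.measurable_exp.comp_aemeasurable ?_).ennreal_ofReal
    refine Finset.aemeasurable_fun_sum _ fun t _ => ?_
    exact ((((aemeasurable_nextProb (hB t)).comp_quasiMeasurePreserving
      (measurePreserving_samplePrefix D t.isLt.le).quasiMeasurePreserving).ennreal_toReal).const_mul
      _).sub ((hxm t).const_mul _)
  have hGm : AEMeasurable G (Measure.pi fun _ => D) := by
    rw [funext hG]
    exact (Real.measurable_exp.comp_aemeasurable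
      ((Finset.aemeasurable_fun_sum _ fun t _ => hxm t).const_mul _)).ennreal_ofReal
  have h2δ : (0 : ℝ) < 2 / δ := by positivity
  have hFle := (mul_meas_ge_le_lintegral₀ hFm (ENNReal.ofReal (2 / δ))).trans
    (lintegral_exp_martingale_le_one hl a hB m)
  have hGle := (mul_meas_ge_le_lintegral₀ hGm (ENNReal.ofReal (Real.exp K * (2 / δ)))).trans
    (lintegral_prod_reversed_le hB hloo hc ha ham)
  rw [ENNReal.ofReal_mul (Real.exp_nonneg _), mul_assoc, ← hK] at hGle
  have hGle' : ENNReal.ofReal (2 / δ) * (Measure.pi fun _ : Fin m => D)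
      {S | ENNReal.ofReal (Real.exp K) * ENNReal.ofReal (2 / δ) ≤ G S} ≤ 1 := by
    have hne : ENNReal.ofReal (Real.exp K) ≠ 0 := by simp [Real.exp_pos]
    rw [← ENNReal.mul_le_mul_iff_right hne ENNReal.ofReal_ne_top, mul_one]
    exact hGle
  have hhalf : ∀ x : ℝ≥0∞, ENNReal.ofReal (2 / δ) * x ≤ 1 → x ≤ ENNReal.ofReal (δ / 2) := by
    intro x hx
    have hne : ENNReal.ofReal (2 / δ) ≠ 0 := by simpa using h2δ
    rw [← ENNReal.mul_le_mul_iff_right hne ENNReal.ofReal_ne_top, ← ENNReal.ofReal_mul h2δ.le]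
    refine hx.trans (le_of_eq ?_)
    rw [div_mul_div_cancel₀ (by positivity)]
    simp
  calc _ ≤ (Measure.pi fun _ : Fin m => D) ({S | ENNReal.ofReal (2 / δ) ≤ F S} ∪
        {S | ENNReal.ofReal (Real.exp K) * ENNReal.ofReal (2 / δ) ≤ G S}) := by
        refine measure_mono fun S hS => ?_
        by_contra hcon
        simp only [Set.mem_union, Set.mem_ofPred_eq, not_or, not_le] at hcon
        obtain ⟨h1, h2⟩ := hcon
        rw [hG, ← ENNReal.ofReal_mul (Real.exp_nonneg _)] at h2
        have h1 := (ENNReal.ofReal_lt_ofReal_iff h2δ).1 h1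
        have h2 := (ENNReal.ofReal_lt_ofReal_iff (by positivity)).1 h2
        rw [← Real.exp_log h2δ, Real.exp_lt_exp, Finset.sum_sub_distrib, ← Finset.mul_sum,
          ← Finset.mul_sum, ← hL] at h1
        rw [← Real.exp_log h2δ, ← Real.exp_add, Real.exp_lt_exp, ← hL] at h2
        have hS : l / η * (K + L) + L ≤ (1 - Real.exp (-l)) * _ := hS
        set sx := ∑ t : Fin m with a ≤ Fin.val t, (B t).indicator (1 : (Fin (t + 1) → Z) → ℝ) (samplePrefix t.isLt S)
        have h3 : l / η * (η * sx) ≤ l / η * (K + L) :=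
          mul_le_mul_of_nonneg_left h2.le (by positivity)
        have h4 : l / η * (η * sx) = l * sx := by field_simp
        linarith
    _ ≤ ENNReal.ofReal (δ / 2) + ENNReal.ofReal (δ / 2) :=
        (measure_union_le _ _).trans (add_le_add (hhalf _ hFle) (hhalf _ hGle'))
    _ = _ := by rw [← ENNReal.ofReal_add (by positivity) (by positivity)]; simp
end

/-! ### The plurality vote over the prefixes -/

section
variable {X Y : Type*}

lemma prefixVotes_le (P : Learner X Y) {m : ℕ} (S : Fin m → X × Y) (x : X) (y : Y) :
    prefixVotes P S x y ≤ m := by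
  refine (Set.ncard_le_ncard (Set.subset_univ _) (Set.toFinite _)).trans ?_
  simp [Set.ncard_univ]

/-- The plurality vote over the prefixes of the sample. -/
noncomputable def pluralityLearner [Nonempty Y] (P : Learner X Y) : Learner X Y := fun m S x =>
  -- Minimizing a natural number works for infinitely many labels; votes never exceed `m`, so the
  -- truncated subtraction is exact.
  Function.argmin fun y => m - prefixVotes P S x y

lemma isPrefixMajority_pluralityLearner [Nonempty Y] (P : Learner X Y) :
    IsPrefixMajority P (pluralityLearner P) := by
  intro m S x y
  have h := Function.argmin_le (fun y => m - prefixVotes P S x y) y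
  have h1 := prefixVotes_le P S x y
  have h2 := prefixVotes_le P S x (pluralityLearner P m S x)
  change m - prefixVotes P S x (pluralityLearner P m S x) ≤ m - prefixVotes P S x y at h
  omega

lemma snoc_mem_errorSet_iff {P : Learner X Y} {t : ℕ} {S : Fin t → X × Y} {p : X × Y} :
    Fin.snoc (α := fun _ => X × Y) S p ∈ errorSet P t ↔ P t S p.1 ≠ p.2 := by
  rw [errorSet, Set.mem_ofPred_eq, Fin.init_snoc, Fin.snoc_last]

/-- Where the plurality vote errs, at least half of the voters err. -/
lemma IsPrefixMajority.card_le_two_mul_sum {P A : Learner X Y} (hA : IsPrefixMajority P A) {m : ℕ}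
    (S : Fin m → X × Y) {p : X × Y} (hp : A m S p.1 ≠ p.2) :
    ((m - (m + 3) / 4 : ℕ) : ℝ≥0∞) ≤ 2 * ∑ t : Fin m with (m + 3) / 4 ≤ Fin.val t,
      (errorSet P t).indicator 1
        (Fin.snoc (α := fun _ => X × Y) (samplePrefix t.isLt.le S) p) := by
  classical
  let T : Finset (Fin m) := {t | (m + 3) / 4 ≤ Fin.val t}
  have hT : T.card = m - (m + 3) / 4 := by
    have h : (T.map Fin.valEmbedding) = Finset.Ico ((m + 3) / 4) m := by
      ext k
      simp only [Finset.mem_map, Finset.mem_filter, Finset.mem_univ, true_and,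
        Fin.valEmbedding_apply, Finset.mem_Ico, T]
      exact ⟨fun ⟨t, ht, hk⟩ => hk ▸ ⟨ht, t.isLt⟩, fun ⟨h1, h2⟩ => ⟨⟨k, h2⟩, h1, rfl⟩⟩
    rw [← Finset.card_map Fin.valEmbedding, h, Nat.card_Ico]
  have hvotes : ∀ y, prefixVotes P S p.1 y =
      (T.filter fun t : Fin m => P t (samplePrefix t.isLt.le S) p.1 = y).card := by
    intro y
    rw [prefixVotes, ← Set.ncard_coe_finset]
    congr 1
    ext t
    simp only [Set.mem_ofPred_eq, Finset.coe_filter, T, Finset.mem_filter, Finset.mem_univ,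
      true_and]
    -- `(m + 3) / 4` is `m / 4` rounded up.
    refine and_congr ⟨fun h => by omega, fun h => by omega⟩ Iff.rfl
  have hle := hA m S p.1 p.2
  rw [hvotes, hvotes] at hle
  -- The voters for the winning wrong label all err, and they are at least as many as the correct
  -- voters.
  have hsub : (T.filter fun t : Fin m => P t (samplePrefix t.isLt.le S) p.1 = A m S p.1) ⊆
      T.filter fun t : Fin m => ¬ P t (samplePrefix t.isLt.le S) p.1 = p.2 := by
    intro t ht
    rw [Finset.mem_filter] at ht ⊢
    exact ⟨ht.1, fun h => hp (ht.2.symm.trans h)⟩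
  have hle2 := Finset.card_le_card hsub
  have hadd := Finset.card_filter_add_card_filter_not (s := T)
    (fun t : Fin m => P t (samplePrefix t.isLt.le S) p.1 = p.2)
  have hsum : ∑ t : Fin m with (m + 3) / 4 ≤ Fin.val t, (errorSet P t).indicator
      (1 : (Fin (t + 1) → X × Y) → ℝ≥0∞) (Fin.snoc (α := fun _ => X × Y) (samplePrefix t.isLt.le S) p) =
      ((T.filter fun t : Fin m => ¬ P t (samplePrefix t.isLt.le S) p.1 = p.2).card : ℝ≥0∞) := by
    rw [Finset.card_filter, Nat.cast_sum]
    refine Finset.sum_congr rfl fun t _ => ?_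
    rw [Set.indicator_apply]
    simp only [snoc_mem_errorSet_iff]
    split_ifs <;> simp_all
  rw [hsum]
  exact_mod_cast (by omega : m - (m + 3) / 4 ≤
    2 * (T.filter fun t : Fin m => ¬ P t (samplePrefix t.isLt.le S) p.1 = p.2).card)

variable [MeasurableSpace X] [MeasurableSpace Y]

/-- The error of the plurality vote is at most twice the average error of the voters. -/
lemma IsPrefixMajority.ae_mul_err_le {P A : Learner X Y} (hA : IsPrefixMajority P A)
    {D : Measure (X × Y)} [IsProbabilityMeasure D]
    (hB : ∀ t, NullMeasurableSet (errorSet P t) (Measure.pi fun _ => D)) (m : ℕ) :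
    ∀ᵐ S ∂(Measure.pi fun _ : Fin m => D), ((m - (m + 3) / 4 : ℕ) : ℝ≥0∞) * err D (A m S) ≤
      2 * ∑ t : Fin m with (m + 3) / 4 ≤ Fin.val t,
        nextProb D (errorSet P) t (samplePrefix t.isLt.le S) := by
  have hall : ∀ᵐ S ∂(Measure.pi fun _ : Fin m => D), ∀ t : Fin m, AEMeasurable
      (fun p => (errorSet P t).indicator (1 : (Fin (t + 1) → X × Y) → ℝ≥0∞)
        (Fin.snoc (α := fun _ => X × Y) (samplePrefix t.isLt.le S) p)) D :=
    ae_all_iff.2 fun t => (measurePreserving_samplePrefix D t.isLt.le).quasiMeasurePreserving.ae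
      (ae_aemeasurable_indicator_snoc (hB t))
  filter_upwards [hall] with S hS
  have hm : AEMeasurable (fun p => 2 * ∑ t : Fin m with (m + 3) / 4 ≤ Fin.val t,
      (errorSet P t).indicator (1 : (Fin (t + 1) → X × Y) → ℝ≥0∞)
        (Fin.snoc (α := fun _ => X × Y) (samplePrefix t.isLt.le S) p)) D :=
    (Finset.aemeasurable_fun_sum _ fun t _ => hS t).const_mul _
  -- Markov's inequality in the test point, at the level given by half of the voters.
  refine le_trans ?_ ((mul_meas_ge_le_lintegral₀ hm ((m - (m + 3) / 4 : ℕ) : ℝ≥0∞)).trans ?_)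
  · gcongr
    exact measure_mono fun p hp => hA.card_le_two_mul_sum S hp
  · rw [lintegral_const_mul'' _ (Finset.aemeasurable_fun_sum _ fun t _ => hS t),
      lintegral_finsetSum' _ fun t _ => hS t]
    rfl
end

/-! ### The numerical constants -/

/-- For `d ≥ 1`, take `exp (-l) = 0.4455` and `exp η = 2.52`. Since `0.4455 ^ 6 ≥ 2 ^ (-7)` and
`2.52 ^ 3 ≥ 2 ^ 4`, the ratio `l / η` is at most `7 / 8`. The left side is then about `3.69 d + 3.75
L`, against `0.5545 * (12 / 17) * 9.64 * (d + L)`, about `3.77 (d + L)`, on the right. -/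
lemma exists_tail_parameters {d m : ℕ} {ε L : ℝ} (hε0 : 0 < ε) (hε1 : ε < 1)
    (hL : Real.log 2 ≤ L) (hm : 9.64 * ((d + L) / ε) ≤ m) :
    ∃ l η : ℝ, 0 ≤ l ∧ 0 < η ∧ 0 < 1 - Real.exp (-l) ∧ 1 ≤ (m + 3) / 4 ∧ (m + 3) / 4 < m ∧
      2 * (l / η * ((Real.exp η - 1) * d * (Real.log m - Real.log ((m + 3) / 4 : ℕ)) + L) + L) ≤
        (1 - Real.exp (-l)) * ((m - (m + 3) / 4 : ℕ) * ε) := by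
  have hlog1 := Real.log_two_gt_d9
  have hlog2 := Real.log_two_lt_d9
  have hd0 : (0 : ℝ) ≤ d := Nat.cast_nonneg d
  have hmε : 9.64 * (d + L) ≤ m * ε := by
    rwa [← mul_div_assoc, div_le_iff₀ hε0] at hm
  have hmL : 9.64 * (d + L) ≤ m := hmε.trans (mul_le_of_le_one_right (Nat.cast_nonneg m) hε1.le)
  -- `9.64 * log 2 > 6`; thus `3 / 4 * (m - 1)` is at least `9 / 14 * m`.
  have hm7 : 7 ≤ m := by
    have : (6 : ℝ) < m := by linarith
    exact_mod_cast this
  set a := (m + 3) / 4 with ha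
  have ha1 : 1 ≤ a := by omega
  have ham : a < m := by omega
  have h4a : (m : ℝ) ≤ 4 * a := by exact_mod_cast (by omega : m ≤ 4 * a)
  have h4a' : 4 * (a : ℝ) ≤ m + 3 := by exact_mod_cast (by omega : 4 * a ≤ m + 3)
  have hN : 3 / 4 * ((m : ℝ) - 1) ≤ ((m - a : ℕ) : ℝ) := by
    rw [Nat.cast_sub ham.le]; linarith
  have hmpos : (0 : ℝ) < m := by exact_mod_cast (by omega : 0 < m)
  have hapos : (0 : ℝ) < a := by exact_mod_cast ha1
  have hloga : Real.log m - Real.log a ≤ 2 * Real.log 2 := by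
    have h1 : Real.log m ≤ Real.log (4 * a) := Real.log_le_log hmpos h4a
    have h2 : Real.log (4 : ℝ) = 2 * Real.log 2 := by
      rw [show (4 : ℝ) = 2 ^ 2 by norm_num, Real.log_pow]; norm_num
    rw [Real.log_mul (by norm_num) hapos.ne', h2] at h1
    linarith
  set l := -Real.log 0.4455 with hl
  have hexp : Real.exp (-l) = 0.4455 := by rw [hl, neg_neg, Real.exp_log (by norm_num)]
  have hl0 : 0 ≤ l := by
    have := Real.log_nonpos (x := 0.4455) (by norm_num) (by norm_num)
    linarith
  have hl1 : 6 * l ≤ 7 * Real.log 2 := by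
    have h1 : Real.log (1 / 2 ^ 7) ≤ Real.log (0.4455 ^ 6) :=
      Real.log_le_log (by norm_num) (by norm_num)
    rw [Real.log_pow, Real.log_div (by norm_num) (by norm_num), Real.log_pow, Real.log_one] at h1
    push_cast at h1
    linarith
  rcases Nat.eq_zero_or_pos d with hd | hd
  · subst hd
    -- For `d = 0` a large `η` is free, as `exp η - 1` is multiplied by `d`. It compensates for the
    -- weaker lower bound on `m`.
    refine ⟨l, 8 * Real.log 2, hl0, by linarith, by rw [hexp]; norm_num, ha1, ham, ?_⟩
    have hr : l / (8 * Real.log 2) ≤ 7 / 48 := by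
      rw [div_le_iff₀ (by linarith)]; linarith
    have h7 : (7 : ℝ) ≤ m := by exact_mod_cast hm7
    have hNε : 9 / 14 * (m * ε) ≤ ((m - a : ℕ) : ℝ) * ε := by
      rw [← mul_assoc]
      exact mul_le_mul_of_nonneg_right (by linarith) hε0.le
    have hL' : l / (8 * Real.log 2) * L ≤ 7 / 48 * L :=
      mul_le_mul_of_nonneg_right hr (by linarith)
    simp only [Nat.cast_zero, zero_add, mul_zero, zero_mul] at hmε ⊢
    rw [hexp]
    linarith
  · have hd1 : (1 : ℝ) ≤ d := by exact_mod_cast hd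
    -- `9.64 * (1 + log 2) > 16`, which improves `9 / 14` to `12 / 17`.
    have hm17 : (17 : ℝ) ≤ m := by
      have : (16 : ℝ) < m := by linarith
      have : 17 ≤ m := by exact_mod_cast this
      exact_mod_cast this
    have hη : 4 * Real.log 2 ≤ 3 * Real.log 2.52 := by
      have h1 : Real.log (2 ^ 4) ≤ Real.log (2.52 ^ 3) :=
        Real.log_le_log (by norm_num) (by norm_num)
      rw [Real.log_pow, Real.log_pow] at h1
      exact_mod_cast h1
    have hη0 : 0 < Real.log 2.52 := by linarith
    refine ⟨l, Real.log 2.52, hl0, hη0, by rw [hexp]; norm_num, ha1, ham, ?_⟩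
    have hr : l / Real.log 2.52 ≤ 7 / 8 := by
      rw [div_le_iff₀ hη0]; linarith
    have hNε : 12 / 17 * (m * ε) ≤ ((m - a : ℕ) : ℝ) * ε := by
      rw [← mul_assoc]
      exact mul_le_mul_of_nonneg_right (by linarith) hε0.le
    rw [hexp, Real.exp_log (by norm_num)]
    have hK : (2.52 - 1) * (d : ℝ) * (Real.log m - Real.log a) ≤ 1.52 * d * 1.3863 := by
      have : (2.52 - 1 : ℝ) = 1.52 := by norm_num
      rw [this]
      exact mul_le_mul_of_nonneg_left (by linarith) (by positivity)
    have hmul : l / Real.log 2.52 *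
        ((2.52 - 1) * (d : ℝ) * (Real.log m - Real.log a) + L) ≤ 7 / 8 * (1.52 * d * 1.3863 + L) :=
      (mul_le_mul_of_nonneg_left (by linarith) (by positivity)).trans
        (mul_le_mul_of_nonneg_right hr (by nlinarith))
    linarith

/-! ### The upper bound -/

section
variable {X Y : Type*} [MeasurableSpace X] [MeasurableSpace Y]

/-- The sample complexity bound of the plurality vote over one-inclusion graph predictors. -/
lemma measure_err_pluralityLearner_gt_le [Countable Y] [Nonempty Y] [DiscreteMeasurableSpace Y]
    {H : Set (X → Y)} {d : ℕ} (hH : MeasurablePatterns H) (hd : HasDSDim H d) {φ : X → ℝ}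
    (hφ : Measurable φ) (hinj : Function.Injective φ) (D : Measure (X × Y))
    [IsProbabilityMeasure D] (hD : Realizable H D) {ε δ : ℝ} (hε : ε ∈ Set.Ioo (0 : ℝ) 1)
    (hδ : δ ∈ Set.Ioo (0 : ℝ) 1) {m : ℕ} (hm : 9.64 * ((d + Real.log (2 / δ)) / ε) ≤ (m : ℝ)) :
    Measure.pi (fun _ : Fin m => D)
      {S | ENNReal.ofReal ε < err D (pluralityLearner (oigPredictor H φ) m S)} ≤
      ENNReal.ofReal δ := by
  have hB := fun t => nullMeasurableSet_errorSet hH hφ t D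
  have hloo : LeaveOneOutBound D (errorSet (oigPredictor H φ)) d := fun t => by
    filter_upwards [hD.ae_mem_restrict (t + 1)] with S hS
    exact exists_leaveOneOut hd hinj hS
  have hL : Real.log 2 ≤ Real.log (2 / δ) :=
    Real.log_le_log two_pos ((le_div_iff₀ hδ.1).2 (by linarith [hδ.2]))
  obtain ⟨l, η, hl, hη, hκ, ha, ham, hnum⟩ := exists_tail_parameters hε.1 hε.2 hL hm
  refine le_trans ?_ (measure_sum_nextProb_ge_le hB hloo hl hη hδ.1 ha ham.le)
  refine measure_mono_ae ?_
  filter_upwards [(isPrefixMajority_pluralityLearner (oigPredictor H φ)).ae_mul_err_le hB m]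
    with S hS hlt
  have hlt : ENNReal.ofReal ε < err D (pluralityLearner (oigPredictor H φ) m S) := hlt
  change _ ≤ _
  by_contra hcon
  rw [not_le] at hcon
  set q := ∑ t : Fin m with (m + 3) / 4 ≤ Fin.val t,
    (nextProb D (errorSet (oigPredictor H φ)) t (samplePrefix t.isLt.le S)).toReal with hq
  have hsum : ∑ t : Fin m with (m + 3) / 4 ≤ Fin.val t,
      nextProb D (errorSet (oigPredictor H φ)) t (samplePrefix t.isLt.le S) =
      ENNReal.ofReal q := by
    rw [hq, ENNReal.ofReal_sum_of_nonneg fun _ _ => ENNReal.toReal_nonneg]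
    exact Finset.sum_congr rfl fun t _ =>
      (ENNReal.ofReal_toReal ((nextProb_le_one _ _).trans_lt ENNReal.one_lt_top).ne).symm
  rw [hsum] at hS
  have hqN : 2 * q ≤ (m - (m + 3) / 4 : ℕ) * ε := by
    have h := mul_lt_mul_of_pos_left hcon (two_pos (α := ℝ))
    refine le_of_mul_le_mul_left (a := 1 - Real.exp (-l)) ?_ hκ
    linarith
  have hN : ((m - (m + 3) / 4 : ℕ) : ℝ≥0∞) ≠ 0 := by
    rw [Nat.cast_ne_zero]; omega
  have h1 : ((m - (m + 3) / 4 : ℕ) : ℝ≥0∞) * err D (pluralityLearner (oigPredictor H φ) m S) ≤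
      (m - (m + 3) / 4 : ℕ) * ENNReal.ofReal ε := by
    refine hS.trans ?_
    rw [← ENNReal.ofReal_natCast, ← ENNReal.ofReal_mul (Nat.cast_nonneg _),
      show (2 : ℝ≥0∞) = ENNReal.ofReal 2 by simp, ← ENNReal.ofReal_mul zero_le_two]
    exact ENNReal.ofReal_le_ofReal hqN
  rw [ENNReal.mul_le_mul_iff_right hN (ENNReal.natCast_ne_top _)] at h1
  exact absurd hlt (not_lt.2 h1)

/-- A bound for errors exceeding `ε / 2` is a bound for errors of at least `ε`. -/
lemma learnsFrom_of_forall_measure_le {H : Set (X → Y)} {A : Learner X Y} {d : ℕ}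
    (h : ∀ D : Measure (X × Y), IsProbabilityMeasure D → Realizable H D →
      ∀ ε ∈ Set.Ioo (0 : ℝ) 1, ∀ δ ∈ Set.Ioo (0 : ℝ) 1, ∀ m : ℕ,
        9.64 * ((d + Real.log (2 / δ)) / ε) ≤ (m : ℝ) →
        Measure.pi (fun _ : Fin m => D) {S | ENNReal.ofReal ε < err D (A m S)} ≤ ENNReal.ofReal δ)
    {ε δ : ℝ} (hε : ε ∈ Set.Ioo (0 : ℝ) 1) (hδ : δ ∈ Set.Ioo (0 : ℝ) 1) :
    LearnsFrom H A ε δ ⌈9.64 * ((d + Real.log (2 / δ)) / (ε / 2))⌉₊ := by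
  intro D hD hreal m hm
  have hε2 : ε / 2 ∈ Set.Ioo (0 : ℝ) 1 := ⟨by linarith [hε.1], by linarith [hε.1, hε.2]⟩
  refine le_trans (measure_mono fun S hS => ?_) (h D hD hreal (ε / 2) hε2 δ hδ m (Nat.ceil_le.1 hm))
  refine lt_of_lt_of_le ?_ (show ENNReal.ofReal ε ≤ err D (A m S) from hS)
  exact (ENNReal.ofReal_lt_ofReal_iff hε.1).2 (by linarith [hε.1])
end

/-! ### Finitely supported distributions -/

/-- The distribution on `{0, …, k}` with mass `p` spread evenly over the nonzero elements. -/
noncomputable def spreadMeasure (k : ℕ) (p : ℝ) : Measure (Fin (k + 1)) :=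
  ENNReal.ofReal (1 - p) • Measure.dirac 0 +
    ∑ i : Fin k, ENNReal.ofReal (p / k) • Measure.dirac i.succ

lemma spreadMeasure_apply (k : ℕ) (p : ℝ) (s : Set (Fin (k + 1))) :
    spreadMeasure k p s = ENNReal.ofReal (1 - p) * s.indicator 1 0 +
      ∑ i : Fin k, ENNReal.ofReal (p / k) * s.indicator 1 i.succ := by
  simp [spreadMeasure]

lemma isProbabilityMeasure_spreadMeasure {k : ℕ} (hk : 0 < k) {p : ℝ} (hp0 : 0 ≤ p) (hp1 : p ≤ 1) :
    IsProbabilityMeasure (spreadMeasure k p) := by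
  refine ⟨?_⟩
  have hk' : (0 : ℝ) < k := by exact_mod_cast hk
  rw [spreadMeasure_apply]
  simp only [Set.indicator_univ, Pi.one_apply, mul_one, Finset.sum_const, Finset.card_univ,
    Fintype.card_fin, nsmul_eq_mul]
  rw [← ENNReal.ofReal_natCast, ← ENNReal.ofReal_mul hk'.le,
    ← ENNReal.ofReal_add (by linarith) (by positivity), mul_div_cancel₀ _ hk'.ne']
  simp

lemma spreadMeasure_zero (k : ℕ) (p : ℝ) : spreadMeasure k p {0} = ENNReal.ofReal (1 - p) := by
  rw [spreadMeasure_apply]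
  simp

lemma spreadMeasure_succ (k : ℕ) (p : ℝ) (i : Fin k) :
    spreadMeasure k p {i.succ} = ENNReal.ofReal (p / k) := by
  rw [spreadMeasure_apply, Finset.sum_eq_single i]
  · simp [(Fin.succ_ne_zero i).symm]
  · intro j _ hj
    simp [hj]
  · simp

lemma ofReal_mul_card_le_spreadMeasure (k : ℕ) {p : ℝ} (hp : 0 ≤ p) (s : Set (Fin (k + 1)))
    [DecidablePred fun i : Fin k => i.succ ∈ s] :
    ENNReal.ofReal (p / k * (Finset.univ.filter fun i : Fin k => i.succ ∈ s).card) ≤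
      spreadMeasure k p s := by
  rw [spreadMeasure_apply, ← Finset.mul_sum, ENNReal.ofReal_mul (by positivity),
    ENNReal.ofReal_natCast]
  refine le_trans (le_of_eq ?_) le_add_self
  classical
  rw [Finset.card_filter, Nat.cast_sum]
  congr 1
  refine Finset.sum_congr rfl fun i _ => ?_
  by_cases hi : i.succ ∈ s <;> simp [hi]

open Classical in
/-- On a pseudo-cube, a prediction at an unseen coordinate is wrong for at least half of the
members. -/
lemma card_le_two_mul_card_filter_ne {Y : Type*} {k : ℕ} {F : Finset (Fin k → Y)} {i : Fin k}
    (hF : ∀ f ∈ F, ∃ g ∈ F, IsNeighbor i f g) (pred : (Fin k → Y) → Y)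
    (hpred : ∀ f g : Fin k → Y, (∀ j, j ≠ i → f j = g j) → pred f = pred g) :
    F.card ≤ 2 * (F.filter fun f => pred f ≠ f i).card := by
  choose! g hgF hg using hF
  -- Passing to the neighbour keeps the prediction and changes the label, so it maps correct members
  -- to wrong ones. It is injective on correct members: two with a common neighbour agree off `i`,
  -- and at `i` both equal their common prediction.
  have hle : (F.filter fun f => pred f = f i).card ≤ (F.filter fun f => pred f ≠ f i).card := by
    refine Finset.card_le_card_of_injOn g (fun f hf => ?_) fun f hf f' hf' heq => ?_
    · obtain ⟨hfF, hf⟩ := Finset.mem_filter.1 hf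
      refine Finset.mem_coe.2 (Finset.mem_filter.2 ⟨hgF f hfF, ?_⟩)
      rw [← hpred f (g f) (hg f hfF).2, hf]
      exact (hg f hfF).1
    · obtain ⟨hfF, hf⟩ := Finset.mem_filter.1 hf
      obtain ⟨hfF', hf'⟩ := Finset.mem_filter.1 hf'
      have hoff : ∀ j, j ≠ i → f j = f' j := fun j hj => by
        rw [(hg f hfF).2 j hj, (hg f' hfF').2 j hj, heq]
      funext j
      by_cases hj : j = i
      · rw [hj, ← hf, ← hf', hpred f f' hoff]
      · exact hoff j hj
  have hadd := Finset.card_filter_add_card_filter_not (s := F) (fun f => pred f = f i)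
  simp only [ne_eq] at hle ⊢
  omega

section
variable {X Y : Type*} [MeasurableSpace X] [MeasurableSpace Y] [MeasurableSingletonClass X]
  [MeasurableSingletonClass Y]

/-- The guarantee of a learner for a finitely supported realizable distribution. -/
lemma LearnsFrom.measure_index_le {H : Set (X → Y)} {A : Learner X Y} {ε δ : ℝ} {M k : ℕ}
    (hA : LearnsFrom H A ε δ M) (ν : Measure (Fin k)) [IsProbabilityMeasure ν] (x : Fin k → X)
    {f : Fin k → Y} (hf : f ∈ restrict H x) :
    (Measure.pi fun _ : Fin M => ν) {J | ENNReal.ofReal ε ≤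
      ν {i | A M (fun j => (x (J j), f (J j))) (x i) ≠ f i}} ≤ ENNReal.ofReal δ := by
  have hm : AEMeasurable (fun i => (x i, f i)) ν := (measurable_of_finite _).aemeasurable
  set D := ν.map fun i => (x i, f i) with hD
  have hprob : IsProbabilityMeasure D := Measure.isProbabilityMeasure_map hm
  obtain ⟨h, hh, rfl⟩ := hf
  have hreal : Realizable H D := by
    refine le_antisymm ?_ zero_le
    refine (iInf₂_le h hh).trans (le_of_eq ?_)
    refine measure_mono_null (t := (Set.range fun i => (x i, h (x i)))ᶜ) ?_ ?_
    · rintro p hp ⟨i, rfl⟩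
      exact hp rfl
    · rw [hD, Measure.map_apply_of_aemeasurable hm (Set.finite_range _).measurableSet.compl]
      simp
  have hpi : (Measure.pi fun _ : Fin M => D) =
      (Measure.pi fun _ : Fin M => ν).map fun J j => (x (J j), (h ∘ x) (J j)) :=
    (Measure.pi_map_pi fun _ => hm).symm
  refine le_trans ?_ (hA D hprob hreal M le_rfl)
  rw [hpi]
  -- A pushforward dominates the measure of the preimage for arbitrary sets, so the learner need not
  -- be measurable.
  refine le_trans (measure_mono fun J hJ => ?_)
    (Measure.le_map_apply (measurable_of_finite _).aemeasurable _)
  refine le_trans (show ENNReal.ofReal ε ≤ _ from hJ) ?_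
  exact Measure.le_map_apply hm _

/-! ### The lower bounds -/

/-- A learner needs enough examples to see the rare point that distinguishes two functions. -/
lemma LearnsFrom.one_sub_pow_le {H : Set (X → Y)} (hH : Nondegenerate H) {A : Learner X Y}
    {ε δ : ℝ} {M : ℕ} (hε0 : 0 ≤ ε) (hε1 : ε ≤ 1) (hδ : 0 ≤ δ) (hA : LearnsFrom H A ε δ M) :
    (1 - ε) ^ M ≤ δ := by
  obtain ⟨h, hh, g, hg, x, x', hx, hx'⟩ := hH
  have := isProbabilityMeasure_spreadMeasure one_pos hε0 hε1
  let z : Fin 2 → X := ![x, x']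
  have hsample : (fun _ : Fin M => (z 0, (h ∘ z) 0)) = fun _ => (z 0, (g ∘ z) 0) := by
    simp [z, hx]
  have key : ∀ f : Fin 2 → Y, f ∈ restrict H z → A M (fun _ => (z 0, f 0)) (z 1) ≠ f 1 →
      (1 - ε) ^ M ≤ δ := by
    intro f hf hne
    have hle := hA.measure_index_le (spreadMeasure 1 ε) z hf
    have hsub : Set.pi Set.univ (fun _ : Fin M => ({0} : Set (Fin 2))) ⊆
        {J | ENNReal.ofReal ε ≤ spreadMeasure 1 ε
          {i | A M (fun j => (z (J j), f (J j))) (z i) ≠ f i}} := by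
      intro J hJ
      have hJ0 : J = fun _ => 0 := funext fun j => hJ j (Set.mem_univ j)
      subst hJ0
      have h1 := spreadMeasure_succ 1 ε 0
      simp only [Nat.cast_one, div_one] at h1
      change ENNReal.ofReal ε ≤ _
      rw [← h1]
      refine measure_mono fun i hi => ?_
      rw [Set.mem_singleton_iff.1 hi]
      exact hne
    have h2 := (measure_mono hsub).trans hle
    rw [Measure.pi_pi, spreadMeasure_zero] at h2
    simp only [Finset.prod_const, Finset.card_univ, Fintype.card_fin] at h2
    rw [← ENNReal.ofReal_pow (by linarith)] at h2
    exact (ENNReal.ofReal_le_ofReal_iff hδ).1 h2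
  -- On samples that show only `x`, the prediction at `x'` is the same for both targets, so one of
  -- the two is missed.
  by_cases hc : A M (fun _ => (z 0, (h ∘ z) 0)) (z 1) = h x'
  · refine key (g ∘ z) ⟨g, hg, rfl⟩ ?_
    rw [← hsample, hc]
    exact hx'
  · exact key (h ∘ z) ⟨h, hh, rfl⟩ hc

/-- A learner needs to see a constant fraction of the rare points of a shattered sequence. -/
lemma LearnsFrom.le_mul_of_shatters {H : Set (X → Y)} {k : ℕ} (hk : 0 < k) {x : Fin (k + 1) → X}
    (hx : DSShatters H x) {A : Learner X Y} {ε δ : ℝ} {M : ℕ} (hε0 : 0 < ε) (hε : ε ≤ 1 / 8)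
    (hδ0 : 0 ≤ δ) (hδ : δ ≤ 1 / 8) (hA : LearnsFrom H A ε δ M) : (k : ℝ) ≤ 16 * ε * M := by
  classical
  obtain ⟨F', hfin, hne, hFH, hnb⟩ := hx
  obtain ⟨F, rfl⟩ := hfin.exists_finset_coe
  -- With nothing seen, half of the rare mass is missed on average: `2 ε`, twice the threshold.
  set p := 4 * ε with hp
  have hk' : (0 : ℝ) < k := by exact_mod_cast hk
  have hprob := isProbabilityMeasure_spreadMeasure hk (p := p) (by linarith) (by linarith)
  set ν := spreadMeasure k p with hν
  set q := p / k with hq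
  have hq0 : 0 ≤ q := by rw [hq]; positivity
  set P := Measure.pi fun _ : Fin M => ν with hP
  let wrong : (Fin (k + 1) → Y) → (Fin M → Fin (k + 1)) → Set (Fin (k + 1)) := fun f J =>
    {i | A M (fun j => (x (J j), f (J j))) (x i) ≠ f i}
  let bad : (Fin (k + 1) → Y) → Set (Fin M → Fin (k + 1)) := fun f =>
    {J | ENNReal.ofReal ε ≤ ν (wrong f J)}
  let seen : Fin k → Set (Fin M → Fin (k + 1)) := fun i => ⋃ j, (fun J => J j) ⁻¹' {i.succ}
  have hbad : ∀ f ∈ F, P.real (bad f) ≤ δ := fun f hf =>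
    ENNReal.toReal_le_of_le_ofReal hδ0 (hA.measure_index_le ν x (hFH hf))
  have hseen : ∀ i, P.real (seen i) ≤ M * q := by
    intro i
    refine ENNReal.toReal_le_of_le_ofReal (by positivity) ?_
    refine (measure_iUnion_fintype_le _ _).trans (le_of_eq ?_)
    rw [Finset.sum_congr rfl fun j _ => (measurePreserving_eval (fun _ : Fin M => ν)
      j).measure_preimage (measurableSet_singleton _).nullMeasurableSet]
    simp only [hν, spreadMeasure_succ, Finset.sum_const, Finset.card_univ, Fintype.card_fin,
      nsmul_eq_mul]
    rw [ENNReal.ofReal_mul (Nat.cast_nonneg M), ENNReal.ofReal_natCast]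
  -- For each fixed sample, the error is averaged over targets in `F`: at an unseen point at least
  -- half of `F` is predicted wrongly, while a target outside `bad` has error below `ε`.
  have hpoint : ∀ J, (F.card : ℝ) * p ≤ ∑ f ∈ F, (2 * ε + 2 * p * (bad f).indicator 1 J) +
      F.card * q * ∑ i, (seen i).indicator 1 J := by
    intro J
    have hcoord : ∀ i : Fin k, (F.card : ℝ) ≤
        2 * (F.filter fun f => i.succ ∈ wrong f J).card + F.card * (seen i).indicator 1 J := by
      intro i
      by_cases hi : J ∈ seen i
      · rw [Set.indicator_of_mem hi]
        simp
      · rw [Set.indicator_of_notMem hi, mul_zero, add_zero]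
        have := card_le_two_mul_card_filter_ne (F := F) (i := i.succ)
          (fun f hf => hnb f hf i.succ) (fun f => A M (fun j => (x (J j), f (J j))) (x i.succ))
          (fun f g hfg => by
            have : (fun j => (x (J j), f (J j))) = fun j => (x (J j), g (J j)) := by
              funext j
              rw [hfg (J j) fun hj => hi (Set.mem_iUnion.2 ⟨j, hj⟩)]
            simp only [this])
        exact_mod_cast this
    have herr : ∀ f, q * (Finset.univ.filter fun i : Fin k => i.succ ∈ wrong f J).card ≤
        ε + p * (bad f).indicator 1 J := by
      intro f
      by_cases hJ : J ∈ bad f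
      · rw [Set.indicator_of_mem hJ]
        have hcard : ((Finset.univ.filter fun i : Fin k => i.succ ∈ wrong f J).card : ℝ) ≤ k := by
          exact_mod_cast (Finset.card_filter_le _ _).trans (by simp)
        have : q * k = p := div_mul_cancel₀ _ hk'.ne'
        have := mul_le_mul_of_nonneg_left hcard hq0
        simp only [Pi.one_apply, mul_one]
        linarith
      · rw [Set.indicator_of_notMem hJ, mul_zero, add_zero]
        have h1 := ofReal_mul_card_le_spreadMeasure k (p := p) (by linarith) (wrong f J)
        have h2 : ν (wrong f J) < ENNReal.ofReal ε := not_le.1 hJ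
        exact ((ENNReal.ofReal_lt_ofReal_iff hε0).1 (h1.trans_lt h2)).le
    have hswap : ∑ i : Fin k, ((F.filter fun f => i.succ ∈ wrong f J).card : ℝ) =
        ∑ f ∈ F, ((Finset.univ.filter fun i : Fin k => i.succ ∈ wrong f J).card : ℝ) := by
      simp only [Finset.card_filter, Nat.cast_sum]
      exact Finset.sum_comm
    calc (F.card : ℝ) * p = q * ∑ _i : Fin k, (F.card : ℝ) := by
          simp only [Finset.sum_const, Finset.card_univ, Fintype.card_fin, nsmul_eq_mul, hq]
          field_simp
      _ ≤ q * ∑ i : Fin k, (2 * ((F.filter fun f => i.succ ∈ wrong f J).card : ℝ) +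
            F.card * (seen i).indicator 1 J) :=
          mul_le_mul_of_nonneg_left (Finset.sum_le_sum fun i _ => hcoord i) hq0
      _ = 2 * ∑ f ∈ F, q * ((Finset.univ.filter fun i : Fin k => i.succ ∈ wrong f J).card : ℝ) +
            F.card * q * ∑ i, (seen i).indicator 1 J := by
          rw [Finset.sum_add_distrib, ← Finset.mul_sum, ← Finset.mul_sum, ← Finset.mul_sum, hswap]
          ring
      _ ≤ _ := by
          rw [Finset.mul_sum]
          gcongr with f hf
          have := herr f
          linarith
  have hint : ∀ s : Set (Fin M → Fin (k + 1)), ∫ J, s.indicator (1 : (Fin M → Fin (k + 1)) → ℝ) J ∂P = P.real s :=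
    fun s => integral_indicator_one s.toFinite.measurableSet
  have hI : ∀ u : (Fin M → Fin (k + 1)) → ℝ, Integrable u P := fun u => Integrable.of_finite
  have hmono := integral_mono (hI _) (hI _) hpoint
  simp only [integral_add (hI _) (hI _), integral_finsetSum _ fun _ _ => hI _, integral_const_mul, hint,
    integral_const, probReal_univ, one_smul] at hmono
  have h1 : ∑ f ∈ F, (2 * ε + 2 * p * P.real (bad f)) ≤ F.card * (2 * ε + 2 * p * (1 / 8)) := by
    rw [← nsmul_eq_mul]
    refine Finset.sum_le_card_nsmul _ _ _ fun f hf => ?_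
    have := (hbad f hf).trans hδ
    gcongr
  have h2 : ∑ i, P.real (seen i) ≤ k * (M * q) := by
    refine (Finset.sum_le_card_nsmul _ _ _ fun i _ => hseen i).trans (le_of_eq ?_)
    simp
  have hFpos : (0 : ℝ) < F.card := by
    exact_mod_cast Finset.card_pos.2 (Finset.coe_nonempty.1 hne)
  have h3 : (F.card : ℝ) * p ≤ F.card * (2 * ε + 2 * p * (1 / 8) + q * (k * (M * q))) := by
    have := mul_le_mul_of_nonneg_left h2 (mul_nonneg hFpos.le hq0)
    linarith
  have h4 := le_of_mul_le_mul_left h3 hFpos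
  have h5 : q * k = p := div_mul_cancel₀ _ hk'.ne'
  -- After integration and division by `|F|`: `4 ε ≤ 2 ε + ε + 4 ε (M q)`.
  have h6 : ε ≤ 4 * ε * (M * q) := by
    have : q * (k * (M * q)) = p * (M * q) := by rw [← mul_assoc, h5]
    rw [this, hp] at h4
    linarith
  have h7 : 1 ≤ 4 * (M * q) := by
    refine le_of_mul_le_mul_left (a := ε) ?_ hε0
    linarith
  have h8 : 4 * (M * q) * k = 16 * ε * M := by
    rw [hq, hp]
    field_simp
    ring
  rw [← h8]
  exact le_mul_of_one_le_left hk'.le h7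

/-- The lower bound on the sample complexity of any learner. -/
lemma LearnsFrom.lower_bound {H : Set (X → Y)} {d : ℕ} (hd : HasDSDim H d) (hH : Nondegenerate H)
    {A : Learner X Y} {ε δ : ℝ} {M : ℕ} (hε : ε ∈ Set.Ioc (0 : ℝ) (1 / 8))
    (hδ : δ ∈ Set.Ioc (0 : ℝ) (1 / 8)) (hA : LearnsFrom H A ε δ M) :
    1 / 64 * ((d + Real.log (1 / δ)) / ε) ≤ (M : ℝ) := by
  have hlog : Real.log (1 / δ) = -Real.log δ := by rw [one_div, Real.log_inv]
  have hL1 : 1 ≤ Real.log (1 / δ) := by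
    rw [Real.le_log_iff_exp_le (by have := hδ.1; positivity)]
    refine Real.exp_one_lt_d9.le.trans ?_
    rw [le_div_iff₀ hδ.1]
    linarith [hδ.2]
  have hlow : 7 / 8 * Real.log (1 / δ) ≤ ε * M := by
    have h1 := hA.one_sub_pow_le hH hε.1.le (by linarith [hε.2]) hδ.1.le
    have hpos : (0 : ℝ) < 1 - ε := by linarith [hε.2]
    have h2 := Real.log_le_log (pow_pos hpos M) h1
    rw [Real.log_pow] at h2
    have h3 := Real.one_sub_inv_le_log_of_pos hpos
    have h4 : (1 - ε)⁻¹ ≤ 1 + 8 / 7 * ε := by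
      rw [inv_le_comm₀ hpos (by linarith [hε.1]), inv_le_iff_one_le_mul₀ (by linarith [hε.1])]
      nlinarith [hε.1, hε.2]
    have h5 : (M : ℝ) * (-(8 / 7 * ε)) ≤ M * Real.log (1 - ε) :=
      mul_le_mul_of_nonneg_left (by linarith) (Nat.cast_nonneg M)
    rw [hlog]
    linarith
  rw [← mul_div_assoc, div_le_iff₀ hε.1]
  rcases Nat.lt_or_ge d 2 with hd2 | hd2
  · have : (d : ℝ) ≤ 1 := by exact_mod_cast Nat.lt_succ_iff.1 hd2
    linarith
  · obtain ⟨k, rfl⟩ : ∃ k, d = k + 1 := ⟨d - 1, by omega⟩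
    obtain ⟨x, hx⟩ := hd.1
    have h1 := hA.le_mul_of_shatters (by omega) hx hε.1 hε.2 hδ.1.le hδ.2
    push_cast
    linarith
end

/-! ### Assembling the upper and lower bounds -/

lemma HasDSDim.nonempty {X Y : Type*} {H : Set (X → Y)} {d : ℕ} (hd : HasDSDim H d) :
    H.Nonempty := by
  obtain ⟨x, F, -, ⟨f, hf⟩, hsub, -⟩ := hd.1
  obtain ⟨h, hh, -⟩ := hsub hf
  exact ⟨h, hh⟩

lemma exists_measurable_injective_real (X : Type*) [MeasurableSpace X]
    [MeasurableSpace.CountablySeparated X] :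
    ∃ φ : X → ℝ, Measurable φ ∧ Function.Injective φ := by
  obtain ⟨f, hf, hinj⟩ := MeasurableSpace.measurable_injection_nat_bool_of_countablySeparated X
  have he := measurableEmbedding_embeddingReal (ℕ → Bool)
  exact ⟨embeddingReal (ℕ → Bool) ∘ f, he.measurable.comp hf, he.injective.comp hinj⟩

/-- Over an empty domain every learner is a one-inclusion graph predictor. -/
lemma isOIGPredictor_of_isEmpty {X Y : Type*} [IsEmpty X] (H : Set (X → Y)) (P : Learner X Y) :
    IsOIGPredictor H P := by
  have hn : ∀ n, (Fin n → X) → IsEmpty (Fin n) := fun n x => ⟨fun i => isEmptyElim (x i)⟩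
  refine ⟨fun n x i => (hn n x).elim i, fun n x => ?_, fun n x π w _ i => (hn n x).elim i,
    fun n S x => isEmptyElim x⟩
  have := hn n x
  exact ⟨fun i => isEmptyElim i, fun σ' _ r _ w _ => by
    rw [outdeg, Set.eq_empty_of_isEmpty {i : Fin n | _}, Set.ncard_empty]
    exact Nat.zero_le r⟩

lemma exists_learner {X Y : Type*} [MeasurableSpace X] [MeasurableSpace.CountablySeparated X]
    [Countable Y] [MeasurableSpace Y] [DiscreteMeasurableSpace Y] {H : Set (X → Y)} {d : ℕ}
    (hH : MeasurablePatterns H) (hd : HasDSDim H d) :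
    ∃ P A : Learner X Y, IsOIGPredictor H P ∧ IsPrefixMajority P A ∧
      ∀ D : Measure (X × Y), IsProbabilityMeasure D → Realizable H D →
        ∀ ε ∈ Set.Ioo (0 : ℝ) 1, ∀ δ ∈ Set.Ioo (0 : ℝ) 1, ∀ m : ℕ,
          9.64 * ((d + Real.log (2 / δ)) / ε) ≤ (m : ℝ) →
          Measure.pi (fun _ : Fin m => D) {S | ENNReal.ofReal ε < err D (A m S)}
            ≤ ENNReal.ofReal δ := by
  rcases isEmpty_or_nonempty X with hX | hX
  · refine ⟨fun _ _ x => isEmptyElim x, fun _ _ x => isEmptyElim x, isOIGPredictor_of_isEmpty H _,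
      fun m S x => isEmptyElim x, fun D hD => ?_⟩
    have h1 := hD.measure_univ
    rw [Set.univ_eq_empty_iff.2 inferInstance, measure_empty] at h1
    exact absurd h1 zero_ne_one
  · have : Nonempty Y := hd.nonempty.elim fun h _ => ⟨h hX.some⟩
    obtain ⟨φ, hφ, hinj⟩ := exists_measurable_injective_real X
    exact ⟨oigPredictor H φ, pluralityLearner (oigPredictor H φ),
      isOIGPredictor_oigPredictor H hinj, isPrefixMajority_pluralityLearner _,
      fun D _ hD ε hε δ hδ m hm => measure_err_pluralityLearner_gt_le hH hd hφ hinj D hD hε hδ hm⟩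

/-- Halving `ε` doubles `9.64` to `19.28`, and `log 2 ≤ log (1 / δ)` doubles the confidence term to
`38.56`. The rest of `40` absorbs the rounding. -/
lemma ceil_sample_size_le {d : ℕ} {ε δ : ℝ} (hε : ε ∈ Set.Ioc (0 : ℝ) (1 / 8))
    (hδ : δ ∈ Set.Ioc (0 : ℝ) (1 / 8)) :
    (⌈9.64 * ((d + Real.log (2 / δ)) / (ε / 2))⌉₊ : ℝ) ≤ 40 * ((d + Real.log (1 / δ)) / ε) := by
  have hε0 := hε.1
  have hlog2 := Real.log_two_gt_d9
  have hL : Real.log 2 ≤ Real.log (1 / δ) :=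
    Real.log_le_log two_pos ((le_div_iff₀ hδ.1).2 (by linarith [hδ.2]))
  have hsplit : Real.log (2 / δ) = Real.log 2 + Real.log (1 / δ) := by
    rw [← Real.log_mul two_ne_zero (by have := hδ.1; positivity), mul_one_div]
  have hd0 : (0 : ℝ) ≤ d := Nat.cast_nonneg d
  have hpos : 0 ≤ 9.64 * ((d + Real.log (2 / δ)) / (ε / 2)) := by
    have : 0 ≤ d + Real.log (2 / δ) := by linarith
    positivity
  refine (Nat.ceil_lt_add_one hpos).le.trans ?_
  have h1 : 9.64 * ((d + Real.log (2 / δ)) / (ε / 2)) + 1 =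
      (19.28 * (d + Real.log (2 / δ)) + ε) / ε := by
    field_simp
    ring
  rw [h1, ← mul_div_assoc]
  refine div_le_div_of_nonneg_right ?_ hε0.le
  rw [hsplit]
  linarith [hε.2]

theorem corollary1 :
    ∃ c C : ℝ, 0 < c ∧ 0 < C ∧
      ∀ (X Y : Type*) [MeasurableSpace X] [MeasurableSpace.CountablySeparated X]
        [Countable Y] [MeasurableSpace Y] [DiscreteMeasurableSpace Y]
        (H : Set (X → Y)) (d : ℕ), MeasurablePatterns H → HasDSDim H d →
        (∃ P A : Learner X Y, IsOIGPredictor H P ∧ IsPrefixMajority P A ∧ PACLearns H A ∧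
          ∀ D : Measure (X × Y), IsProbabilityMeasure D → Realizable H D →
            ∀ ε ∈ Set.Ioo (0 : ℝ) 1, ∀ δ ∈ Set.Ioo (0 : ℝ) 1, ∀ m : ℕ,
              9.64 * ((d + Real.log (2 / δ)) / ε) ≤ (m : ℝ) →
              Measure.pi (fun _ : Fin m => D) {S | ENNReal.ofReal ε < err D (A m S)}
                ≤ ENNReal.ofReal δ) ∧
        (Nondegenerate H →
          ∀ ε ∈ Set.Ioc (0 : ℝ) (1 / 8), ∀ δ ∈ Set.Ioc (0 : ℝ) (1 / 8),
            ∃ M : ℕ, IsOptimalSampleComplexity H ε δ M ∧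
              c * ((d + Real.log (1 / δ)) / ε) ≤ (M : ℝ) ∧
              (M : ℝ) ≤ C * ((d + Real.log (1 / δ)) / ε)) := by
  refine ⟨1 / 64, 40, by norm_num, by norm_num, ?_⟩
  intro X Y _ _ _ _ _ H d hH hd
  obtain ⟨P, A, hP, hA, hbound⟩ := exists_learner hH hd
  refine ⟨⟨P, A, hP, hA, ⟨_, fun ε hε δ hδ => learnsFrom_of_forall_measure_le hbound hε hδ⟩,
    hbound⟩, fun hnd ε hε δ hδ => ?_⟩
  have := MeasurableSpace.measurableSingletonClass_of_countablySeparated (α := X)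
  have hlearn := learnsFrom_of_forall_measure_le hbound (ε := ε) (δ := δ)
    ⟨hε.1, by linarith [hε.2]⟩ ⟨hδ.1, by linarith [hδ.2]⟩
  have hleast : IsOptimalSampleComplexity H ε δ
      (sInf {M : ℕ | ∃ A : Learner X Y, LearnsFrom H A ε δ M}) :=
    ⟨Nat.sInf_mem ⟨_, A, hlearn⟩, fun M hM => Nat.sInf_le hM⟩
  refine ⟨_, hleast, ?_, ?_⟩
  · obtain ⟨A', hA'⟩ := hleast.1
    exact hA'.lower_bound hd hnd hε hδ
  · refine le_trans ?_ (ceil_sample_size_le hε hδ)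
    exact_mod_cast hleast.2 ⟨A, hlearn⟩
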